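/- Let $(M,I)$ be a complex manifold and let $E\to M$ be a holomorphic vector bundle, regarded as a real vector bundle with fibrewise complex structure $J$. A compatible (Hermitian) metric on $E$ is a smooth positive definite fibre metric $g$ on the real bundle $E$ with $g(J\cdot,J\cdot)=g(\cdot,\cdot)$; $\nabla^{Ch}$ denotes its Chern connection, viewed as a connection on the real bundle $E$. **Twistor spaces.** Let $\pi\colon\mathcal T(g)\to M$ be the bundle whose fibre over $x$ consists of all real endomorphisms $K$ of $E_x$ with $K^2=-1$ and $g(K\cdot,K\cdot)=g(\cdot,\cdot)$; it is a submanifold of the total space of $\mathrm{End}\,E$. A $g$-metric connection $\nabla$ on $E$ splits $T\mathcal T(g)$ into the vertical bundle and the horizontal bundle, which consists of the velocities of $\nabla$-parallel translates. The almost complex structure $\mathcal J^{(\nabla,I)}$ on $\mathcal T(g)$ is given at $K$ by $A\mapsto KA$ on vertical vectors $A\in \mathrm{End}\,E_x$ and by $v^\nabla\mapsto (Iv)^\nabla$ on horizontal lifts $v^\nabla$ of $v\in T_xM$. **The connections.** Write $E_{\mathbb C}=E\otimes_{\mathbb R}\mathbb C=E^{1,0}\oplus E^{0,1}$ for the decomposition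 into the $\pm i$-eigenbundles of $J$, let $E^{*1,0}$ be the complex dual of $E^{1,0}$, and put $\langle X+\mu,Y+\nu\rangle=\tfrac12(\mu(Y)+\nu(X))$ on $E^{1,0}\oplus E^{*1,0}$. Let $\mathcal D'^{0,1}$ be a smooth section of $T^{*0,1}\otimes\mathfrak{so}(E^{1,0}\oplus E^{*1,0})$. For a compatible metric $g$, extended complex bilinearly, let $1\oplus g\colon E_{\mathbb C}=E^{1,0}\oplus E^{0,1}\to E^{1,0}\oplus E^{*1,0}$ be the isomorphism that is the identity on $E^{1,0}$ and $u\mapsto g(u,\cdot)$ on $E^{0,1}$. Put $\mathcal D_g^{0,1}=(1\oplus g)^{-1}\circ\mathcal D'^{0,1}\circ(1\oplus g)$ and $\mathcal D_g=\mathcal D_g^{0,1}+\overline{\mathcal D_g^{0,1}}$. Then $\nabla^{Ch}+\mathcal D_g$ is a $g$-metric connection on the real bundle $E$. **Theorem.** Let $g$ and $g'$ be two compatible metrics on $E$, with Chern connections $\nabla^{Ch}$ and $\nabla^{Ch'}$. 1. For every $\mathcal D'^{0,1}$ as above there is a fibre preserving biholomorphism between $(\mathcal T(g),\mathcal J^{(\nabla^{Ch}+\mathcal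 D_g,I)})$ and $(\mathcal T(g'),\mathcal J^{(\nabla^{Ch'}+\mathcal D_{g'},I)})$, that is, a diffeomorphism $\mathcal T(g)\to\mathcal T(g')$ over the identity of $M$ whose differential intertwines the two almost complex structures. (When $(\bar\partial+\mathcal D'^{0,1})^2=0$, these structures are integrable, and this is a biholomorphism of complex manifolds in the usual sense.) 2. In particular, there is a fibre preserving biholomorphism between $(\mathcal T(g),\mathcal J^{(\nabla^{Ch},I)})$ and $(\mathcal T(g'),\mathcal J^{(\nabla^{Ch'},I)})$. -/

import Mathlib

open Bundle Manifold
open scoped ContDiff Topology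

noncomputable section

namespace TwistorSpace

/-! ### Underlying real structures of complex manifolds and complex vector bundles -/

section RealStructures

/-- The smooth real manifold underlying a complex manifold. -/
instance isManifold_real {H : Type*} [NormedAddCommGroup H] [NormedSpace ℂ H]
    {M : Type*} [TopologicalSpace M] [ChartedSpace H M] [IsManifold 𝓘(ℂ, H) ω M] :
    IsManifold 𝓘(ℝ, H) ∞ M := by
  apply isManifold_of_contDiffOn
  intro e e' he he'
  have h := contDiffGroupoid_le (I := 𝓘(ℂ, H)) (m := ∞) le_top
    ((contDiffGroupoid ω 𝓘(ℂ, H)).compatible he he')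
  exact ((mem_groupoid_of_pregroupoid
    (PG := contDiffPregroupoid ∞ 𝓘(ℂ, H))).1 h).1.restrict_scalars ℝ

instance continuousSMul_real {V : Type*} [AddCommGroup V] [Module ℂ V] [TopologicalSpace V]
    [ContinuousSMul ℂ V] : ContinuousSMul ℝ V where
  continuous_smul := by
    have : Continuous fun p : ℝ × V => (p.1 : ℂ) • p.2 := by fun_prop
    simpa using this

variable {M : Type*} [TopologicalSpace M] {F : Type*} [NormedAddCommGroup F] [NormedSpace ℂ F]
  {E : M → Type*} [TopologicalSpace (TotalSpace F E)]
  [∀ x, AddCommGroup (E x)] [∀ x, Module ℂ (E x)]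

instance isLinear_real (e : Trivialization F (π F E)) [e.IsLinear ℂ] : e.IsLinear ℝ where
  linear b hb :=
    { map_add := (e.linear ℂ hb).map_add
      map_smul := fun c v => by
        have := (e.linear ℂ hb).map_smul (c : ℂ) v
        simpa using this }

/-- The real vector bundle underlying a complex vector bundle. -/
instance vectorBundle_real [∀ x, TopologicalSpace (E x)] [FiberBundle F E] [VectorBundle ℂ F E] :
    VectorBundle ℝ F E where
  trivialization_linear' e he := inferInstance
  continuousOn_coordChange' e e' he he' := by
    have h := VectorBundle.continuousOn_coordChange' (R := ℂ) e e'
    refine ((ContinuousLinearMap.restrictScalarsL ℂ F F ℝ ℝ).continuous.comp_continuousOn h).congr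
      fun b hb => ?_
    ext v
    simp [Trivialization.coordChangeL_apply _ _ hb]

end RealStructures

theorem finiteDimensional_of_equiv {V F : Type*} [AddCommGroup V] [Module ℂ V] [TopologicalSpace V]
    [NormedAddCommGroup F] [NormedSpace ℂ F] [FiniteDimensional ℂ F] (e : V ≃L[ℝ] F) :
    FiniteDimensional ℝ V :=
  e.symm.toLinearEquiv.finiteDimensional

/-! ### Frames -/

section Frames

variable {M : Type*} [TopologicalSpace M]
  (F : Type*) [NormedAddCommGroup F] [NormedSpace ℂ F]
  (E : M → Type*) [TopologicalSpace (TotalSpace F E)]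
  [∀ x, AddCommGroup (E x)] [∀ x, Module ℂ (E x)] [∀ x, TopologicalSpace (E x)]
  [FiberBundle F E] [VectorBundle ℂ F E]

/-- The coordinates on the fibre `E x` given by the preferred local frame of `E` around `x`. -/
def frameAt (x : M) : E x ≃L[ℝ] F :=
  (trivializationAt F E x).continuousLinearEquivAt ℝ x
    (FiberBundle.mem_baseSet_trivializationAt F E x)

end Frames

variable {H : Type*} [NormedAddCommGroup H] [NormedSpace ℂ H] [FiniteDimensional ℂ H]
  {M : Type*} [TopologicalSpace M] [ChartedSpace H M]
  {F : Type*} [NormedAddCommGroup F] [NormedSpace ℂ F] [FiniteDimensional ℂ F]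
  {E : M → Type*} [TopologicalSpace (TotalSpace F E)]
  [∀ x, AddCommGroup (E x)] [∀ x, Module ℂ (E x)] [∀ x, TopologicalSpace (E x)]
  [∀ x, IsTopologicalAddGroup (E x)] [∀ x, ContinuousSMul ℂ (E x)]
  [FiberBundle F E] [VectorBundle ℂ F E]

/-- The complex structure `I` of the complex manifold `M` on the tangent space at `x`. -/
def tangentI (x : M) : TangentSpace 𝓘(ℝ, H) x →L[ℝ] TangentSpace 𝓘(ℝ, H) x :=
  (Complex.I • ContinuousLinearMap.id ℝ H : H →L[ℝ] H)

/-! ### Hermitian metrics -/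

variable (H F E) in
/-- A smooth positive definite metric `g` on the real bundle underlying `E` that is compatible with
the fibrewise complex structure `J` (multiplication by `i`): `g(J·, J·) = g(·, ·)`. -/
structure HermitianMetric extends ContMDiffRiemannianMetric 𝓘(ℝ, H) ∞ F E where
  compatible (x : M) (u w : E x) : inner x (Complex.I • u) (Complex.I • w) = inner x u w

/-- The fibre at `x` of the dual bundle `E* = Hom_ℂ(E, ℂ)`. -/
abbrev DualFiber (E : M → Type*) [∀ x, AddCommGroup (E x)] [∀ x, Module ℂ (E x)]
    [∀ x, TopologicalSpace (E x)] (x : M) : Type _ :=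
  E x →L[ℂ] Bundle.Trivial M ℂ x

namespace HermitianMetric

variable (g : HermitianMetric H F E)

theorem inner_bijective (x : M) : Function.Bijective (g.inner x) := by
  have := (frameAt F E x).toHomeomorph.symm.t2Space
  have := finiteDimensional_of_equiv (frameAt F E x)
  have hinj : Function.Injective (g.inner x) := by
    rw [injective_iff_map_eq_zero]
    intro u hu
    by_contra h
    have := g.pos x u h
    simp [hu] at this
  let L : E x →ₗ[ℝ] Module.Dual ℝ (E x) := LinearMap.toContinuousLinearMap.symm.toLinearMap ∘ₗ
    (g.inner x).toLinearMap
  have hL : Function.Injective L :=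
    (LinearMap.toContinuousLinearMap (𝕜 := ℝ) (E := E x) (F' := ℝ)).symm.injective.comp hinj
  refine ⟨hinj, fun φ => ?_⟩
  obtain ⟨u, hu⟩ := (LinearMap.injective_iff_surjective_of_finrank_eq_finrank
    (Subspace.dual_finrank_eq).symm).1 hL (φ : E x →ₗ[ℝ] ℝ)
  refine ⟨u, ?_⟩
  ext w
  exact congrArg (fun f : Module.Dual ℝ (E x) => f w) hu

/-- The linear isomorphism `u ↦ g(u, ·)` of the real fibre with its real dual. -/
def toRealDual (x : M) : E x ≃ₗ[ℝ] (E x →L[ℝ] ℝ) :=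
  LinearEquiv.ofBijective (g.inner x).toLinearMap (g.inner_bijective x)

/-- The complex linear functional `w ↦ g(u^{0,1}, w^{1,0})` on `E x`, where `g` is extended complex
bilinearly to `E_ℂ`, `u^{0,1} = (u + i J u) / 2` and `w^{1,0} = (w - i J w) / 2`; explicitly,
`g(u^{0,1}, w^{1,0}) = (g(u, w) - i g(u, J w)) / 2`. In this way `g` maps `E^{0,1}` to `E^{*1,0}`. -/
def flat (x : M) (u : E x) : DualFiber E x where
  toFun w := ((g.inner x u w : ℂ) - Complex.I * (g.inner x u (Complex.I • w) : ℂ)) / 2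
  map_add' w w' := by simp; ring
  map_smul' c w := by
    have hI : Complex.I • Complex.I • w = -w := by simp [smul_smul]
    have h1 : c • w = c.re • w + c.im • (Complex.I • w) := by
      conv_lhs => rw [← Complex.re_add_im c, add_smul, mul_smul]
      simp
    have h2 : Complex.I • c • w = c.re • (Complex.I • w) - c.im • w := by
      rw [h1, smul_add, smul_comm Complex.I c.re, smul_comm Complex.I c.im, hI]
      module
    have h3 : c = c.re + c.im * Complex.I := (Complex.re_add_im c).symm
    have h4 : ∀ (r : ℝ) (w : E x), g.inner x u (r • w) = r * g.inner x u w := fun r w =>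
      (g.inner x u).map_smul r w
    rw [h2, h1, map_add, map_sub, h4, h4, h4, h4]
    simp only [smul_eq_mul, RingHom.id_apply]
    push_cast
    conv_rhs => rw [h3]
    linear_combination ((c.im : ℂ) * (g.inner x u (Complex.I • w) : ℂ) / 2) * Complex.I_sq
  cont := by fun_prop

/-- The inverse of `flat` on the fibre over `x`: the vector `b` with `g(b^{0,1}, w^{1,0}) = μ(w)` for
all `w`. As the real part of `g(b^{0,1}, w^{1,0})` is `g(b, w) / 2`, it is twice the vector that
represents the real part of `μ`. -/
def sharp (x : M) (μ : DualFiber E x) : E x :=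
  (2 : ℝ) • (g.toRealDual x).symm (Complex.reCLM.comp ((μ : E x →L[ℂ] ℂ).restrictScalars ℝ))

theorem sharp_flat (x : M) (u : E x) : g.sharp x (g.flat x u) = u := by
  rw [sharp, ← map_smul, LinearEquiv.symm_apply_eq]
  ext w
  simp [flat, toRealDual]
  ring

theorem flat_add (x : M) (u u' : E x) : g.flat x (u + u') = g.flat x u + g.flat x u' := by
  ext w
  simp [flat]
  ring

theorem flat_smul (x : M) (c : ℝ) (u : E x) : g.flat x (c • u) = c • g.flat x u := by
  ext w
  simp [flat]
  ring

theorem sharp_add (x : M) (μ ν : DualFiber E x) :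
    g.sharp x (μ + ν) = g.sharp x μ + g.sharp x ν := by
  rw [sharp, sharp, sharp, ← smul_add, ← map_add]
  rfl

theorem sharp_smul (x : M) (c : ℝ) (μ : DualFiber E x) : g.sharp x (c • μ) = c • g.sharp x μ := by
  rw [sharp, sharp, smul_comm c, ← map_smul _ c]
  congr 2
  ext w
  simp

/-- The derivative at `x` of the Gram matrix `G` of `g` in the holomorphic frame of `E` around `x`. -/
def gramDeriv (x : M) : TangentSpace 𝓘(ℝ, H) x →L[ℝ] F →L[ℝ] F →L[ℝ] ℝ :=
  mvfderiv 𝓘(ℝ, H) (fun y => (trivializationAt (F →L[ℝ] F →L[ℝ] ℝ)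
    (fun y => E y →L[ℝ] E y →L[ℝ] ℝ) x ⟨y, g.inner y⟩).2) x

/-- Let `h(w, u) = g(w, u) - i g(w, J u)` be the Hermitian form of `g` (complex linear in `u`,
antilinear in `w`). In the holomorphic frame around `x`, this is the functional
`w ↦ Re (∂_v h)(w, u)`, where `∂_v = (d_v - i d_{I v}) / 2` acts on the matrix of `h`. Explicitly,
`Re (∂_v h)(w, u) = (d_v G(u, w) + d_{I v} G(u, J w)) / 2`. -/
def chernFunctional (x : M) (u : E x) (v : TangentSpace 𝓘(ℝ, H) x) : E x →L[ℝ] ℝ :=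
  let e : E x →L[ℝ] F := frameAt F E x
  (1 / 2 : ℝ) • ((g.gramDeriv x v (e u)).comp e +
    (g.gramDeriv x (tangentI x v) (e u)).comp (e.comp (Complex.I • ContinuousLinearMap.id ℝ (E x))))

/-- The connection form `θ = h⁻¹ ∂h` of the Chern connection of `g` in the holomorphic frame of `E`
around `x`, at the point `x`: it is determined by `h(w, θ(v) u) = (∂_v h)(w, u)`. -/
def chernForm (x : M) : E x →ₗ[ℝ] TangentSpace 𝓘(ℝ, H) x →ₗ[ℝ] E x :=
  LinearMap.mk₂ ℝ (fun u v => (g.toRealDual x).symm (g.chernFunctional x u v))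
    (fun u u' v => by
      rw [← map_add]; congr 1; ext w
      simp only [chernFunctional, map_add, add_apply,
        smul_apply, ContinuousLinearMap.comp_apply, smul_eq_mul,
        ContinuousLinearEquiv.coe_coe]
      ring)
    (fun c u v => by
      rw [← map_smul]; congr 1; ext w
      simp only [chernFunctional, map_smul, add_apply,
        smul_apply, ContinuousLinearMap.comp_apply, smul_eq_mul,
        ContinuousLinearEquiv.coe_coe]
      ring)
    (fun u v v' => by
      rw [← map_add]; congr 1; ext w
      simp only [chernFunctional, (g.gramDeriv x).map_add, (tangentI x).map_add, add_apply,
        smul_apply, ContinuousLinearMap.comp_apply, smul_eq_mul]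
      ring)
    (fun c u v => by
      rw [← map_smul]; congr 1; ext w
      simp only [chernFunctional, (g.gramDeriv x).map_smul, (tangentI x).map_smul, add_apply,
        smul_apply, ContinuousLinearMap.comp_apply, smul_eq_mul]
      ring)

end HermitianMetric

/-! ### Connections -/

variable (F) in
/-- An endomorphism-valued one-form at `x`, as a continuous linear map. -/
def formAt (x : M) (A : E x →ₗ[ℝ] TangentSpace 𝓘(ℝ, H) x →ₗ[ℝ] E x) :
    E x →L[ℝ] TangentSpace 𝓘(ℝ, H) x →L[ℝ] E x :=
  haveI := (frameAt F E x).toHomeomorph.symm.t2Space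
  haveI := finiteDimensional_of_equiv (frameAt F E x)
  haveI : FiniteDimensional ℝ (TangentSpace 𝓘(ℝ, H) x) :=
    inferInstanceAs (FiniteDimensional ℝ H)
  haveI : T2Space (TangentSpace 𝓘(ℝ, H) x) := inferInstanceAs (T2Space H)
  LinearMap.toContinuousLinearMap (LinearMap.toContinuousLinearMap.toLinearMap ∘ₗ A)

theorem mvfderiv_congr_of_eventuallyEq {f f' : M → F} {x : M} (h : f =ᶠ[𝓝 x] f') :
    mvfderiv 𝓘(ℝ, H) f x = mvfderiv 𝓘(ℝ, H) f' x := by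
  ext v
  simp only [mvfderiv, h.mfderiv_eq]
  rfl

variable (H F E) in
/-- The operator that sends a section `s` to its derivative at `x` in the preferred frame of `E`
around `x`. -/
def frameDerivative : CovariantDerivative 𝓘(ℝ, H) F E where
  toFun s x := ((frameAt F E x).symm : F →L[ℝ] E x).comp
    (mvfderiv 𝓘(ℝ, H) (fun y => (trivializationAt F E x ⟨y, s y⟩).2) x)
  isCovariantDerivativeOnUniv :=
    { add := fun {σ σ' x} hσ hσ' _ => by
        rw [mdifferentiableAt_section] at hσ hσ'
        have h : (fun y => (trivializationAt F E x ⟨y, (σ + σ') y⟩).2) =ᶠ[𝓝 x]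
            (fun y => (trivializationAt F E x ⟨y, σ y⟩).2 +
              (trivializationAt F E x ⟨y, σ' y⟩).2) := by
          filter_upwards [(trivializationAt F E x).open_baseSet.mem_nhds
            (FiberBundle.mem_baseSet_trivializationAt F E x)] with y hy
          exact ((trivializationAt F E x).linear ℝ hy).map_add (σ y) (σ' y)
        rw [mvfderiv_congr_of_eventuallyEq h, mvfderiv_fun_add hσ hσ',
          ContinuousLinearMap.comp_add]
      leibniz := fun {σ f x} hσ hf _ => by
        rw [mdifferentiableAt_section] at hσ
        have h : (fun y => (trivializationAt F E x ⟨y, (f • σ) y⟩).2) =ᶠ[𝓝 x]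
            (fun y => f y • (trivializationAt F E x ⟨y, σ y⟩).2) := by
          filter_upwards [(trivializationAt F E x).open_baseSet.mem_nhds
            (FiberBundle.mem_baseSet_trivializationAt F E x)] with y hy
          exact ((trivializationAt F E x).linear ℝ hy).map_smul (f y) (σ y)
        have h' : (frameAt F E x).symm (trivializationAt F E x ⟨x, σ x⟩).2 = σ x :=
          (frameAt F E x).symm_apply_apply (σ x)
        rw [mvfderiv_congr_of_eventuallyEq h, mvfderiv_fun_smul hf hσ]
        ext v
        simp [h'] }

namespace HermitianMetric

variable (g : HermitianMetric H F E)

/-- The Chern connection `∇^{Ch}` of `g`, as a connection on the real bundle `E`: it is `d + θ` in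
holomorphic frames, with `θ = h⁻¹ ∂h`. -/
def chernConnection : CovariantDerivative 𝓘(ℝ, H) F E :=
  (frameDerivative H F E).addOneForm fun x => formAt F x (g.chernForm x)

end HermitianMetric

/-! ### The forms `𝒟'^{0,1}` and the associated connections -/

/-- The fibre at `x` of `E^{1,0} ⊕ E^{*1,0}`. Here the holomorphic bundle `E^{1,0}` (the
`+i`-eigenbundle of `J` in `E_ℂ`) is identified with `E` by `w ↦ w^{1,0} = (w - i J w) / 2`. -/
abbrev DoubleFiber (E : M → Type*) [∀ x, AddCommGroup (E x)] [∀ x, Module ℂ (E x)]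
    [∀ x, TopologicalSpace (E x)] (x : M) : Type _ :=
  E x × DualFiber E x

/-- The symmetric pairing `⟨X + μ, Y + ν⟩ = (μ(Y) + ν(X)) / 2` on `E^{1,0} ⊕ E^{*1,0}`. -/
def pairing (x : M) (p q : DoubleFiber E x) : ℂ :=
  ((p.2 q.1 : ℂ) + (q.2 p.1 : ℂ)) / 2

variable [IsManifold 𝓘(ℂ, H) ω M]

variable (H F E) in
/-- A smooth section `𝒟'^{0,1}` of `T^{*0,1} ⊗ 𝔰𝔬(E^{1,0} ⊕ E^{*1,0})`. -/
structure SkewForm where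
  /-- The value on a real tangent vector `v`, that is, on `v^{0,1}`. -/
  toFun (x : M) : TangentSpace 𝓘(ℝ, H) x →ₗ[ℝ] DoubleFiber E x →ₗ[ℂ] DoubleFiber E x
  /-- The form is of type `(0,1)`. -/
  type_zero_one (x : M) (v : TangentSpace 𝓘(ℝ, H) x) (p : DoubleFiber E x) :
    toFun x (tangentI x v) p = -(Complex.I • toFun x v p)
  /-- The values are skew for the pairing. -/
  skew (x : M) (v : TangentSpace 𝓘(ℝ, H) x) (p q : DoubleFiber E x) :
    pairing x (toFun x v p) q + pairing x p (toFun x v q) = 0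
  /-- The form is smooth: applied to smooth local vector fields and smooth local sections of
  `E^{1,0} ⊕ E^{*1,0}`, it gives smooth local sections. -/
  smooth (U : Set M) (hU : IsOpen U) (X : ∀ x : M, TangentSpace 𝓘(ℝ, H) x) (s : ∀ x, E x)
    (μ : ∀ x, DualFiber E x)
    (hX : ContMDiffOn 𝓘(ℝ, H) (𝓘(ℝ, H).prod 𝓘(ℝ, H)) ∞
      (fun x => TotalSpace.mk' H (E := fun x : M => TangentSpace 𝓘(ℝ, H) x) x (X x)) U)
    (hs : ContMDiffOn 𝓘(ℝ, H) (𝓘(ℝ, H).prod 𝓘(ℝ, F)) ∞ (fun x => TotalSpace.mk' F x (s x)) U)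
    (hμ : ContMDiffOn 𝓘(ℝ, H) (𝓘(ℝ, H).prod 𝓘(ℝ, F →L[ℂ] ℂ)) ∞
      (fun x => TotalSpace.mk' (F →L[ℂ] ℂ) (E := DualFiber E) x (μ x)) U) :
    ContMDiffOn 𝓘(ℝ, H) (𝓘(ℝ, H).prod 𝓘(ℝ, F)) ∞
        (fun x => TotalSpace.mk' F x (toFun x (X x) (s x, μ x)).1) U ∧
      ContMDiffOn 𝓘(ℝ, H) (𝓘(ℝ, H).prod 𝓘(ℝ, F →L[ℂ] ℂ)) ∞
        (fun x => TotalSpace.mk' (F →L[ℂ] ℂ) (E := DualFiber E) x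
          (toFun x (X x) (s x, μ x)).2) U

/-- The form `𝒟_g` on the real bundle `E`. On a real vector `u = u^{1,0} + u^{0,1}`, the isomorphism
`1 ⊕ g : E_ℂ = E^{1,0} ⊕ E^{0,1} → E^{1,0} ⊕ E^{*1,0}` takes the value `(u, flat u)`. If `𝒟'^{0,1}`
sends this to `(a, flat b)`, then `𝒟_g^{0,1} u = a^{1,0} + b^{0,1}`, and so
`𝒟_g u = 𝒟_g^{0,1} u + conj (𝒟_g^{0,1} u) = a + b`. -/
def SkewForm.realForm (D : SkewForm H F E) (g : HermitianMetric H F E) (x : M) :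
    E x →ₗ[ℝ] TangentSpace 𝓘(ℝ, H) x →ₗ[ℝ] E x :=
  LinearMap.mk₂ ℝ (fun u v => (D.toFun x v (u, g.flat x u)).1 +
      g.sharp x (D.toFun x v (u, g.flat x u)).2)
    (fun u u' v => by
      have h : (u + u', g.flat x (u + u')) = (u, g.flat x u) + (u', g.flat x u') := by
        rw [g.flat_add]; rfl
      rw [h, map_add, Prod.fst_add, Prod.snd_add, g.sharp_add]; abel)
    (fun c u v => by
      have h : (c • u, g.flat x (c • u)) = c • (u, g.flat x u) := by
        rw [g.flat_smul]; rfl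
      rw [h, LinearMap.map_smul_of_tower, Prod.smul_fst, Prod.smul_snd, g.sharp_smul, smul_add])
    (fun u v v' => by
      rw [map_add, LinearMap.add_apply, Prod.fst_add, Prod.snd_add, g.sharp_add]; abel)
    (fun c u v => by
      rw [map_smul, LinearMap.smul_apply, Prod.smul_fst, Prod.smul_snd, g.sharp_smul, smul_add])

/-- The connection `∇^{Ch} + 𝒟_g` on the real bundle `E`. -/
def HermitianMetric.connection (g : HermitianMetric H F E) (D : SkewForm H F E) :
    CovariantDerivative 𝓘(ℝ, H) F E :=
  g.chernConnection.addOneForm fun x => formAt F x (D.realForm g x)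

/-! ### Twistor spaces -/

variable (F E) in
/-- The total space of the real bundle `End E`. -/
abbrev EndSpace : Type _ := TotalSpace (F →L[ℝ] F) (fun x : M => E x →L[ℝ] E x)

variable (H F) in
/-- The model with corners of the real manifold `End E`. -/
abbrev endModel : ModelWithCorners ℝ (H × (F →L[ℝ] F)) (ModelProd H (F →L[ℝ] F)) :=
  𝓘(ℝ, H).prod 𝓘(ℝ, F →L[ℝ] F)

/-- The twistor space `𝒯(g)`, as a subset (an embedded submanifold) of `End E`: all `K` in the fibres
of `End E` with `K² = -1` and `g(K·, K·) = g(·, ·)`. -/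
def HermitianMetric.twistorSpace (g : HermitianMetric H F E) : Set (EndSpace F E) :=
  {p | (∀ u, p.2 (p.2 u) = -u) ∧ ∀ u w, g.inner p.1 (p.2 u) (p.2 w) = g.inner p.1 u w}

/-- The tangent space of `End E` at `p` in the preferred chart at `p`, which is built from the chart of
`M` and the frame of `E` around `x = π(p)`: this is the tangent vector with component `v ∈ T_x M` in
the directions of `M`, and with component `A ∈ End E_x` in the directions of the fibre. -/
def mkTangent (p : EndSpace F E) (v : TangentSpace 𝓘(ℝ, H) p.1) (A : E p.1 →L[ℝ] E p.1) :
    TangentSpace (endModel H F) p :=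
  ((v, ((frameAt F E p.1 : E p.1 →L[ℝ] F).comp A).comp ((frameAt F E p.1).symm : F →L[ℝ] E p.1)) :
    H × (F →L[ℝ] F))

/-- The component of a tangent vector of `End E` in the directions of `M`; this is its image under the
differential of the projection `End E → M`. -/
def basePart (p : EndSpace F E) (X : TangentSpace (endModel H F) p) : TangentSpace 𝓘(ℝ, H) p.1 :=
  (show H × (F →L[ℝ] F) from X).1

/-- The component `dφ^i_j(X) e_i ⊗ e^j` of a tangent vector `X` of `End E` in the directions of the
fibre, where `φ^i_j` are the fibre coordinates given by the frame `(e_i)` of `E` around `π(p)`. -/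
def fibrePart (p : EndSpace F E) (X : TangentSpace (endModel H F) p) : E p.1 →L[ℝ] E p.1 :=
  (((frameAt F E p.1).symm : F →L[ℝ] E p.1).comp (show H × (F →L[ℝ] F) from X).2).comp
    (frameAt F E p.1 : E p.1 →L[ℝ] F)

variable (F) in
/-- The section of `E` around `x` with value `u` at `x` and with constant coordinates in the frame of `E`
around `x` (extended by zero). -/
def constantSection {x : M} (u : E x) (y : M) : E y :=
  (trivializationAt F E x).symmL ℝ y (frameAt F E x u)

theorem mdifferentiableAt_constantSection {x : M} (u : E x) :
    MDifferentiableAt 𝓘(ℝ, H) (𝓘(ℝ, H).prod 𝓘(ℝ, F))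
      (fun y => TotalSpace.mk' F y (constantSection F u y)) x := by
  rw [mdifferentiableAt_section]
  refine (mdifferentiableAt_const (c := frameAt F E x u)).congr_of_eventuallyEq ?_
  filter_upwards [(trivializationAt F E x).open_baseSet.mem_nhds
    (FiberBundle.mem_baseSet_trivializationAt F E x)] with y hy
  rw [constantSection, Trivialization.symmL_apply _ hy, Trivialization.apply_mk_symm _ hy]

/-- The connection form at `x` in the frame of `E` around `x`: `θ(v) u = ∇_v ũ`, where `ũ` is the
section with constant coordinates in the frame and `ũ(x) = u`. -/
def connectionForm (cov : CovariantDerivative 𝓘(ℝ, H) F E) (x : M) (v : TangentSpace 𝓘(ℝ, H) x) :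
    E x →L[ℝ] E x :=
  haveI := (frameAt F E x).toHomeomorph.symm.t2Space
  haveI := finiteDimensional_of_equiv (frameAt F E x)
  LinearMap.toContinuousLinearMap
    { toFun u := cov (constantSection F u) x v
      map_add' u w := by
        have h : constantSection F (u + w) =
            constantSection F u + (constantSection F w : ∀ y, E y) := by
          funext y
          simp only [constantSection, Pi.add_apply, map_add]
        rw [h, cov.isCovariantDerivativeOnUniv.add
          (mdifferentiableAt_constantSection u) (mdifferentiableAt_constantSection w)]
        rfl
      map_smul' c u := by
        have h : constantSection F (c • u) = c • (constantSection F u : ∀ y, E y) := by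
          funext y
          simp only [constantSection, Pi.smul_apply, map_smul]
        rw [h, cov.isCovariantDerivativeOnUniv.smul_const c (mdifferentiableAt_constantSection u)]
        rfl }

/-- The connection form of the induced connection on `End E`: the covariant derivative at `x`, in
direction `v`, of the section of `End E` with constant coordinates in the frame and value `K`. -/
def endConnectionForm (cov : CovariantDerivative 𝓘(ℝ, H) F E) (x : M)
    (v : TangentSpace 𝓘(ℝ, H) x) (K : E x →L[ℝ] E x) : E x →L[ℝ] E x :=
  (connectionForm cov x v).comp K - K.comp (connectionForm cov x v)

/-- The projection `P^∇` of a tangent vector of `End E` at `K` to the vertical space `End E_x`: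
`P^∇(X) = (π^*∇)_X φ` with `φ` the tautological section of `π^* End E`. -/
def verticalPart (cov : CovariantDerivative 𝓘(ℝ, H) F E) (p : EndSpace F E)
    (X : TangentSpace (endModel H F) p) : E p.1 →L[ℝ] E p.1 :=
  fibrePart p X + endConnectionForm cov p.1 (basePart p X) p.2

/-- The horizontal lift `v^∇` of `v ∈ T_x M` to `K ∈ End E_x`: the velocity of the `∇`-parallel
transport of `K` along a curve in `M` with velocity `v`. In the frame of `E` around `x`, parallel
transport solves `K' + [θ(v), K] = 0`. -/
def horizontalLift (cov : CovariantDerivative 𝓘(ℝ, H) F E) (p : EndSpace F E)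
    (v : TangentSpace 𝓘(ℝ, H) p.1) : TangentSpace (endModel H F) p :=
  mkTangent p v (-endConnectionForm cov p.1 v p.2)

/-- The almost complex structure `𝒥^{(∇, I)}`: at `K`, it sends a vertical vector `A` to `K A` and a
horizontal lift `v^∇` to `(I v)^∇`. -/
def twistorJ (cov : CovariantDerivative 𝓘(ℝ, H) F E) (p : EndSpace F E)
    (X : TangentSpace (endModel H F) p) : TangentSpace (endModel H F) p :=
  mkTangent p 0 (p.2.comp (verticalPart cov p X)) + horizontalLift cov p (tangentI p.1 (basePart p X))

/-- The tangent vectors at `p` of an embedded submanifold `S` of `End E`: the velocities at `0` of the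
smooth curves in `S` that pass through `p` at time `0`. -/
def tangentVectors (S : Set (EndSpace F E)) (p : EndSpace F E) :
    Set (TangentSpace (endModel H F) p) :=
  {X | ∃ c : ℝ → EndSpace F E, ContMDiff 𝓘(ℝ, ℝ) (endModel H F) ∞ c ∧ (∀ t, c t ∈ S) ∧
    (⟨c 0, mfderiv 𝓘(ℝ, ℝ) (endModel H F) c 0 (1 : ℝ)⟩ : TangentBundle (endModel H F) (EndSpace F E))
      = ⟨p, X⟩}

/-- Two embedded submanifolds `S`, `S'` of `End E` with almost complex structures (restrictions of)
`J`, `J'` are related by a fibre preserving biholomorphism: there is a bijection `f : S → S'` over the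
identity of `M`, smooth together with its inverse `f'`, whose differential intertwines `J` and `J'`. -/
def FibrewiseBiholomorphic (S : Set (EndSpace F E))
    (J : ∀ p : EndSpace F E, TangentSpace (endModel H F) p → TangentSpace (endModel H F) p)
    (S' : Set (EndSpace F E))
    (J' : ∀ p : EndSpace F E, TangentSpace (endModel H F) p → TangentSpace (endModel H F) p) :
    Prop :=
  ∃ f f' : EndSpace F E → EndSpace F E,
    Set.MapsTo f S S' ∧ Set.MapsTo f' S' S ∧ Set.LeftInvOn f' f S ∧ Set.RightInvOn f' f S' ∧
    (∀ p ∈ S, (f p).1 = p.1) ∧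
    ContMDiffOn (endModel H F) (endModel H F) ∞ f S ∧
    ContMDiffOn (endModel H F) (endModel H F) ∞ f' S' ∧
    ∀ p ∈ S, ∃ L : TangentSpace (endModel H F) p →L[ℝ] TangentSpace (endModel H F) (f p),
      HasMFDerivWithinAt (endModel H F) (endModel H F) f S p L ∧
      ∀ X ∈ tangentVectors S p, L (J p X) = J' (f p) (L X)

end TwistorSpace
end

noncomputable section

namespace TwistorSpace

set_option linter.unusedSectionVars false

/-! ### The algebra of the comparison map -/

section Algebra

variable {R : Type*} [Ring R]

/-- The operator `(1 + S) + (1 - S) J K`. -/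
def twist (J S K : R) : R := (1 + S) + (1 - S) * J * K

variable {J S T K K' : R}

theorem twist_inverse_mul (hJ : J * J = -1) (hK : K * K = -1) (hJS : J * S = S * J)
    (hTS : T * S = 1) (hK' : K' * twist J S K = twist J S K * K) :
    twist J T K' * twist J S K = (4 : ℤ) • (1 : R) := by
  have h1 : twist J T K' * twist J S K
      = (1 + T) * twist J S K + (1 - T) * J * (twist J S K * K) := by
    rw [← hK', twist]; noncomm_ring
  have h2 : J * (twist J S K * K) = (1 + J * K) - S * (1 - J * K) := by
    unfold twist
    linear_combination (norm := noncomm_ring) hJS * (K + J) + (S - 1) * hJ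
      + J * (1 - S) * J * hK
  rw [h1, mul_assoc, h2]
  unfold twist
  linear_combination (norm := noncomm_ring) hTS * (2 - 2 * J * K)

theorem twist_defect_eq {c c' p q q' r s s' σ ζ : R} 
    (hσ : σ = S * c - c' * S + ζ) (hc : J * c = c * J) (hp : J * p = p * J) (hq : J * q = -(q * J))
    (hr : J * r = -(r * J)) (hs : J * s = s * J) (hqS : q' * S = q) (hsS : s' * S = S * s) :
    σ * (1 - J * K) - (1 - S) * J * ((c + (p + q + r + s)) * K - K * (c + (p + q + r + s)))
        - twist J S K * (c + (p + q + r + s)) + (c' + (p + q' + S * r + s')) * twist J S K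
      = (c' - c + s' - s + q' - S * q) * (1 + J * K)
        + (ζ + S * r * S - r + p * S - S * p) * (1 - J * K) := by
  rw [hσ]
  unfold twist
  linear_combination (norm := noncomm_ring) (S - 1) * hc * K + (S - 1) * hp * K
    + (S - 1) * hq * K + (S - 1) * hr * K + (S - 1) * hs * K
    + hqS * (1 - J * K) + hsS * (1 - J * K)

theorem twist_defect_type {c c₂ c' c₂' p p₂ q q₂ q' q₂' r r₂ s s₂ s' s₂' σ σ₂ ζ ζ₂ : R}
    (hJ : J * J = -1) (hK : K * K = -1) (hJS : J * S = S * J)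
    (hσ : σ = S * c - c' * S + ζ) (hσ₂ : σ₂ = S * c₂ - c₂' * S + ζ₂)
    (hζ : J * ζ = ζ * J) (hc : J * c = c * J) (hc' : J * c' = c' * J)
    (hp : J * p = p * J) (hq : J * q = -(q * J)) (hr : J * r = -(r * J)) (hs : J * s = s * J)
    (hq' : J * q' = -(q' * J)) (hs' : J * s' = s' * J)
    (hqS : q' * S = q) (hsS : s' * S = S * s)
    (hc₂ : c₂ = J * c) (hc₂' : c₂' = J * c') (hζ₂ : ζ₂ = -(J * ζ)) (hp₂ : p₂ = -(J * p))
    (hq₂ : q₂ = -(J * q)) (hq₂' : q₂' = -(J * q')) (hr₂ : r₂ = J * r) (hs₂ : s₂ = J * s)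
    (hs₂' : s₂' = J * s') :
    σ₂ * (1 - J * K)
        - (1 - S) * J * ((c₂ + (p₂ + q₂ + r₂ + s₂)) * K - K * (c₂ + (p₂ + q₂ + r₂ + s₂)))
        - twist J S K * (c₂ + (p₂ + q₂ + r₂ + s₂)) + (c₂' + (p₂ + q₂' + S * r₂ + s₂')) * twist J S K
      = -(σ * (1 - J * K)
        - (1 - S) * J * ((c + (p + q + r + s)) * K - K * (c + (p + q + r + s)))
        - twist J S K * (c + (p + q + r + s)) + (c' + (p + q' + S * r + s')) * twist J S K)
        * K := by
  rw [twist_defect_eq hσ hc hp hq hr hs hqS hsS, twist_defect_eq hσ₂]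
  · have hU : c₂' - c₂ + s₂' - s₂ + q₂' - S * q₂ = (c' - c + s' - s + q' - S * q) * J := by
      subst hc₂ hc₂' hq₂ hq₂' hs₂ hs₂'
      linear_combination (norm := noncomm_ring) hc' - hc + hs' - hs - hq' + S * hq
    have hW : ζ₂ + S * r₂ * S - r₂ + p₂ * S - S * p₂
        = -((ζ + S * r * S - r + p * S - S * p) * J) := by
      subst hζ₂ hr₂ hp₂
      linear_combination (norm := noncomm_ring) -hζ + S * hr * S - hr - hp * S + S * hp
        - S * r * hJS - p * hJS
    rw [hU, hW]
    linear_combination (norm := noncomm_ring)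
      (c' - c + s' - s + q' - S * q) * (hJ * K + J * hK)
        + (ζ + S * r * S - r + p * S - S * p) * (hJ * K - J * hK)
  · rw [hc₂]; linear_combination (norm := noncomm_ring) J * hc
  · rw [hp₂]; linear_combination (norm := noncomm_ring) -J * hp
  · rw [hq₂]; linear_combination (norm := noncomm_ring) -J * hq
  · rw [hr₂]; linear_combination (norm := noncomm_ring) J * hr
  · rw [hs₂]; linear_combination (norm := noncomm_ring) J * hs
  · rw [hq₂', hq₂]; linear_combination (norm := noncomm_ring) -J * hqS
  · rw [hs₂', hs₂]; linear_combination (norm := noncomm_ring) J * hsS + hJS * s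

/-- If `N₁ = σ(1 - JK) - (1 - S)J[θ, K] - Pθ + θ'P` (and `N₂` alike) satisfy `N₂ = -N₁ K`, then the
differential `(v, A) ↦ B` of `K ↦ P K P⁻¹` intertwines the two almost complex structures. -/
theorem intertwines_of_twist {A A₂ B B₂ σ σ₂ θ θ₂ θ' θ₂' Q : R}
    (hK : K * K = -1) (hPQ : twist J S K * Q = 1) (hK' : K' * twist J S K = twist J S K * K)
    (hA : A * K + K * A = 0)
    (hA₂ : A₂ = K * (A + (θ * K - K * θ)) - (θ₂ * K - K * θ₂))
    (hB : B * twist J S K + K' * (σ * (1 - J * K) + (1 - S) * J * A)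
      = (σ * (1 - J * K) + (1 - S) * J * A) * K + twist J S K * A)
    (hB₂ : B₂ * twist J S K + K' * (σ₂ * (1 - J * K) + (1 - S) * J * A₂)
      = (σ₂ * (1 - J * K) + (1 - S) * J * A₂) * K + twist J S K * A₂)
    (hN : σ₂ * (1 - J * K) - (1 - S) * J * (θ₂ * K - K * θ₂) - twist J S K * θ₂
        + θ₂' * twist J S K
      = -(σ * (1 - J * K) - (1 - S) * J * (θ * K - K * θ) - twist J S K * θ
        + θ' * twist J S K) * K) :
    B₂ = K' * (B + (θ' * K' - K' * θ')) - (θ₂' * K' - K' * θ₂') := by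
  set P := twist J S K with hP
  set N := σ * (1 - J * K) - (1 - S) * J * (θ * K - K * θ) - P * θ + θ' * P with hNdef
  set N₂ := σ₂ * (1 - J * K) - (1 - S) * J * (θ₂ * K - K * θ₂) - P * θ₂ + θ₂' * P with hN₂def
  set V := A + (θ * K - K * θ) with hV
  have hVK : V * K + K * V = 0 := by
    rw [hV]; linear_combination (norm := noncomm_ring) hA + θ * hK - hK * θ
  have hKK' : K' * K' = -1 := by
    have h : K' * K' * P * Q = -P * Q := by
      refine congrArg (· * Q) ?_
      linear_combination (norm := noncomm_ring) K' * hK' + hK' * K + P * hK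
    simpa [mul_assoc, hPQ] using h
  -- the vertical parts of the two images, multiplied by `P`
  have hC : (B + (θ' * K' - K' * θ')) * P
      = N * K - K' * N + ((1 - S) * J * V * K + P * V - K' * ((1 - S) * J * V)) := by
    rw [hNdef, hV]
    linear_combination (norm := noncomm_ring) hB + θ' * hK' - hK' * θ
  have hC₂ : (B₂ + (θ₂' * K' - K' * θ₂')) * P
      = N₂ * K - K' * N₂
        + ((1 - S) * J * (K * V) * K + P * (K * V) - K' * ((1 - S) * J * (K * V))) := by
    have : K * V = A₂ + (θ₂ * K - K * θ₂) := by rw [hA₂]; noncomm_ring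
    rw [hN₂def, this]
    linear_combination (norm := noncomm_ring) hB₂ + θ₂' * hK' - hK' * θ₂
  have key : (B₂ + (θ₂' * K' - K' * θ₂')) * P = K' * (B + (θ' * K' - K' * θ')) * P := by
    rw [hC₂, mul_assoc K', hC, hN]
    linear_combination (norm := noncomm_ring) -N * hK + hKK' * N - (1 - S) * J * V * hK
      + hKK' * (1 - S) * J * V - hK' * V + (1 - S) * J * hVK * K - K' * (1 - S) * J * hVK
  have := congrArg (· * Q) key
  simp only [mul_assoc, hPQ, mul_one] at this
  rw [← this]; noncomm_ring

end Algebra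

variable {H : Type*} [NormedAddCommGroup H] [NormedSpace ℂ H] [FiniteDimensional ℂ H]
  {M : Type*} [TopologicalSpace M] [ChartedSpace H M]
  {F : Type*} [NormedAddCommGroup F] [NormedSpace ℂ F] [FiniteDimensional ℂ F]
  {E : M → Type*} [TopologicalSpace (TotalSpace F E)]
  [∀ x, AddCommGroup (E x)] [∀ x, Module ℂ (E x)] [∀ x, TopologicalSpace (E x)]
  [∀ x, IsTopologicalAddGroup (E x)] [∀ x, ContinuousSMul ℂ (E x)]
  [FiberBundle F E] [VectorBundle ℂ F E]

/-! ### The comparison map between two twistor spaces -/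

/-- The complex structure `J` on the fibre `E x`. -/
def fibreJ (E : M → Type*) [∀ x, AddCommGroup (E x)] [∀ x, Module ℂ (E x)]
    [∀ x, TopologicalSpace (E x)] [∀ x, ContinuousSMul ℂ (E x)] (x : M) : E x →L[ℝ] E x :=
  Complex.I • ContinuousLinearMap.id ℝ (E x)

omit [FiberBundle F E] [TopologicalSpace (TotalSpace F E)] [VectorBundle ℂ F E]
  [TopologicalSpace M] [∀ x, IsTopologicalAddGroup (E x)] in
@[simp] theorem fibreJ_apply (x : M) (u : E x) : fibreJ E x u = Complex.I • u := rfl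

theorem fibreJ_mul_fibreJ (x : M) : fibreJ E x * fibreJ E x = -1 := by
  ext u
  simp [smul_smul]

namespace HermitianMetric

variable (g g' : HermitianMetric H F E)

theorem inner_ext {x : M} {u u' : E x} (h : ∀ w, g.inner x u w = g.inner x u' w) : u = u' :=
  (g.inner_bijective x).1 (ContinuousLinearMap.ext h)

theorem inner_I_left (x : M) (u w : E x) :
    g.inner x (Complex.I • u) w = -g.inner x u (Complex.I • w) := by
  have h := g.compatible x u (Complex.I • w)
  rw [smul_smul, Complex.I_mul_I, neg_one_smul, map_neg] at h
  rw [← h, neg_neg]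

/-- The endomorphism `S` of `E x` with `g'(S u, w) = g(u, w)`. -/
def comparison (x : M) : E x →L[ℝ] E x :=
  haveI := (frameAt F E x).toHomeomorph.symm.t2Space
  haveI := finiteDimensional_of_equiv (frameAt F E x)
  LinearMap.toContinuousLinearMap ((g'.toRealDual x).symm.toLinearMap ∘ₗ (g.inner x).toLinearMap)

theorem inner_toRealDual_symm (x : M) (φ : E x →L[ℝ] ℝ) (w : E x) :
    g.inner x ((g.toRealDual x).symm φ) w = φ w :=
  congrArg (fun f : E x →L[ℝ] ℝ => f w) ((g.toRealDual x).apply_symm_apply φ)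

@[simp] theorem inner_comparison (x : M) (u w : E x) :
    g'.inner x (g.comparison g' x u) w = g.inner x u w :=
  g'.inner_toRealDual_symm x (g.inner x u) w

theorem comparison_mul_comparison (x : M) : g'.comparison g x * g.comparison g' x = 1 := by
  ext u
  exact g.inner_ext fun w => by simp

theorem comparison_I (x : M) (u : E x) :
    g.comparison g' x (Complex.I • u) = Complex.I • g.comparison g' x u :=
  g'.inner_ext fun w => by simp [inner_I_left]

theorem fibreJ_mul_comparison (x : M) :
    fibreJ E x * g.comparison g' x = g.comparison g' x * fibreJ E x := by
  ext u
  simp [comparison_I]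

/-- The operator that conjugates the points of `𝒯(g)` into points of `𝒯(g')`. -/
def twistAt (x : M) (K : E x →L[ℝ] E x) : E x →L[ℝ] E x :=
  twist (fibreJ E x) (g.comparison g' x) K

theorem twistAt_apply (x : M) (K : E x →L[ℝ] E x) (u : E x) :
    g.twistAt g' x K u = (u + Complex.I • K u) + g.comparison g' x (u - Complex.I • K u) := by
  simp [twistAt, twist]
  abel

variable {g}

theorem inner_twistAt {x : M} {K : E x →L[ℝ] E x} (hK : ∀ u, K (K u) = -u)
    (hg : ∀ u w, g.inner x (K u) (K w) = g.inner x u w) (u w : E x) :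
    g'.inner x (g.twistAt g' x K (K u)) (g.twistAt g' x K (K w)) =
      g'.inner x (g.twistAt g' x K u) (g.twistAt g' x K w) := by
  set a := u + Complex.I • K u with ha
  set b := u - Complex.I • K u with hb
  set c := w + Complex.I • K w with hc
  set d := w - Complex.I • K w with hd
  have hI : ∀ v : E x, Complex.I • Complex.I • v = -v := fun v => by simp [smul_smul]
  have h1 : ∀ v : E x, K v + Complex.I • K (K v) = -(Complex.I • (v + Complex.I • K v)) :=
    fun v => by rw [smul_add, hI, hK, smul_neg]; abel
  have h2 : ∀ v : E x, K v - Complex.I • K (K v) = Complex.I • (v - Complex.I • K v) :=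
    fun v => by rw [smul_sub, hI, hK, smul_neg]; abel
  have h3 : g.inner x b c + g.inner x a d = 0 := by
    have := g.compatible x (K u) (K w)
    simp only [ha, hb, hc, hd, map_add, map_sub, add_apply, sub_apply, this, hg]
    ring
  have h4 : g'.inner x a (g.comparison g' x d) = g.inner x a d := by
    rw [g'.symm, inner_comparison, g.symm]
  simp only [twistAt_apply, h1, h2, ← ha, ← hb, ← hc, ← hd, comparison_I]
  have e1 : -(Complex.I • a) + Complex.I • g.comparison g' x b
      = Complex.I • (g.comparison g' x b - a) := by rw [smul_sub]; abel
  have e2 : -(Complex.I • c) + Complex.I • g.comparison g' x d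
      = Complex.I • (g.comparison g' x d - c) := by rw [smul_sub]; abel
  rw [e1, e2, g'.compatible]
  simp only [map_add, map_sub, add_apply, sub_apply, inner_comparison, h4]
  linarith

theorem isUnit_twistAt {x : M} {K : E x →L[ℝ] E x} (hK : ∀ u, K (K u) = -u)
    (hg : ∀ u w, g.inner x (K u) (K w) = g.inner x u w) : IsUnit (g.twistAt g' x K) := by
  have := (frameAt F E x).toHomeomorph.symm.t2Space
  have := finiteDimensional_of_equiv (frameAt F E x)
  have hinj : Function.Injective (g.twistAt g' x K) := by
    rw [injective_iff_map_eq_zero]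
    intro u hu
    have hKu : g.twistAt g' x K (K u) = 0 := by
      by_contra h
      have := g'.pos x _ h
      rw [inner_twistAt g' hK hg, hu] at this
      simp at this
    have hI : ∀ v : E x, Complex.I • Complex.I • v = -v := fun v => by simp [smul_smul]
    set a := u + Complex.I • K u with ha
    set b := u - Complex.I • K u with hb
    have hab : a + g.comparison g' x b = 0 := by rw [← hu, twistAt_apply]
    have h1 : K u + Complex.I • K (K u) = -(Complex.I • a) := by
      rw [ha, smul_add, hI, hK, smul_neg]; abel
    have h2 : K u - Complex.I • K (K u) = Complex.I • b := by
      rw [hb, smul_sub, hI, hK, smul_neg]; abel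
    rw [twistAt_apply, h1, h2, comparison_I, neg_add_eq_zero] at hKu
    have hab' : a = g.comparison g' x b := smul_right_injective _ Complex.I_ne_zero hKu
    have ha0 : a = 0 := by
      rw [← hab', ← two_smul ℝ] at hab
      exact (smul_eq_zero_iff_right two_ne_zero).1 hab
    have hb0 : b = 0 := by
      have := congrArg (fun f : E x →L[ℝ] E x => f b) (g.comparison_mul_comparison g' x)
      simpa [← hab', ha0] using this.symm
    have h : (2 : ℝ) • u = a + b := by rw [ha, hb, two_smul]; abel
    rw [ha0, hb0, add_zero] at h
    exact (smul_eq_zero_iff_right two_ne_zero).1 h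
  have hunit : IsUnit (g.twistAt g' x K : E x →ₗ[ℝ] E x) :=
    (LinearMap.isUnit_iff_ker_eq_bot _).2 (LinearMap.ker_eq_bot.2 hinj)
  obtain ⟨Q, hQ, hQ'⟩ := isUnit_iff_exists.1 hunit
  exact isUnit_iff_exists.2 ⟨LinearMap.toContinuousLinearMap Q,
    ContinuousLinearMap.ext fun u => LinearMap.congr_fun hQ u,
    ContinuousLinearMap.ext fun u => LinearMap.congr_fun hQ' u⟩

end HermitianMetric

variable [IsManifold 𝓘(ℂ, H) ω M]

namespace HermitianMetric

variable (g g' : HermitianMetric H F E)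

/-- The comparison map `K ↦ P K P⁻¹` on the fibre over `x`. -/
def conjAt (x : M) (K : E x →L[ℝ] E x) : E x →L[ℝ] E x :=
  g.twistAt g' x K * K * Ring.inverse (g.twistAt g' x K)

/-- The comparison map `K ↦ P K P⁻¹` from `𝒯(g)` to `𝒯(g')`. -/
def twistorMap (p : EndSpace F E) : EndSpace F E :=
  ⟨p.1, g.conjAt g' p.1 p.2⟩

variable {g} {x : M} {K : E x →L[ℝ] E x}

theorem mem_twistorSpace_iff : (⟨x, K⟩ : EndSpace F E) ∈ g.twistorSpace ↔
    (∀ u, K (K u) = -u) ∧ ∀ u w, g.inner x (K u) (K w) = g.inner x u w :=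
  Iff.rfl

theorem mul_self_of_mem_twistorSpace (h : (⟨x, K⟩ : EndSpace F E) ∈ g.twistorSpace) :
    K * K = -1 :=
  ContinuousLinearMap.ext h.1

theorem twistAt_mul_inverse (h : (⟨x, K⟩ : EndSpace F E) ∈ g.twistorSpace) :
    g.twistAt g' x K * Ring.inverse (g.twistAt g' x K) = 1 :=
  Ring.mul_inverse_cancel _ (isUnit_twistAt g' h.1 h.2)

theorem conjAt_mul_twistAt (h : (⟨x, K⟩ : EndSpace F E) ∈ g.twistorSpace) :
    g.conjAt g' x K * g.twistAt g' x K = g.twistAt g' x K * K := by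
  rw [conjAt, mul_assoc, Ring.inverse_mul_cancel _ (isUnit_twistAt g' h.1 h.2), mul_one]

theorem conjAt_mem (hp : (⟨x, K⟩ : EndSpace F E) ∈ g.twistorSpace) :
    (⟨x, g.conjAt g' x K⟩ : EndSpace F E) ∈ g'.twistorSpace := by
  have hsurj : ∀ u, ∃ v, g.twistAt g' x K v = u := fun u =>
    ⟨Ring.inverse (g.twistAt g' x K) u,
      congrArg (fun f : E x →L[ℝ] E x => f u) (twistAt_mul_inverse g' hp)⟩
  have h : ∀ v, g.conjAt g' x K (g.twistAt g' x K v) = g.twistAt g' x K (K v) :=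
    fun v => congrArg (fun f : E x →L[ℝ] E x => f v) (conjAt_mul_twistAt g' hp)
  rw [mem_twistorSpace_iff] at hp ⊢
  refine ⟨fun u => ?_, fun u w => ?_⟩
  · obtain ⟨v, rfl⟩ := hsurj u
    rw [h, h, hp.1, map_neg]
  · obtain ⟨v, rfl⟩ := hsurj u
    obtain ⟨v', rfl⟩ := hsurj w
    rw [h, h]
    exact inner_twistAt g' hp.1 hp.2 v v'

theorem conjAt_conjAt (hp : (⟨x, K⟩ : EndSpace F E) ∈ g.twistorSpace) :
    g'.conjAt g x (g.conjAt g' x K) = K := by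
  have h4 : g'.twistAt g x (g.conjAt g' x K) * g.twistAt g' x K
      = (4 : ℤ) • (1 : E x →L[ℝ] E x) :=
    twist_inverse_mul (fibreJ_mul_fibreJ _) (mul_self_of_mem_twistorSpace hp)
      (fibreJ_mul_comparison g g' _) (comparison_mul_comparison g g' _)
      (conjAt_mul_twistAt g' hp)
  have hPQ := twistAt_mul_inverse g' hp
  have hP'Q := twistAt_mul_inverse g (conjAt_mem g' hp)
  have hP := conjAt_mul_twistAt g' hp
  rw [conjAt]
  generalize g'.twistAt g x (g.conjAt g' x K) = P' at *
  generalize g.conjAt g' x K = K' at *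
  generalize g.twistAt g' x K = P at *
  have key : P' * K' = K * P' := by
    have h : P' * K' * P * Ring.inverse P = K * P' * P * Ring.inverse P := by
      rw [mul_assoc P', hP, ← mul_assoc, h4, mul_assoc K, h4, smul_mul_assoc, mul_smul_comm,
        one_mul, mul_one]
    simpa only [mul_assoc, hPQ, mul_one] using h
  rw [key, mul_assoc, hP'Q, mul_one]

theorem twistorMap_mapsTo : Set.MapsTo (g.twistorMap g') g.twistorSpace g'.twistorSpace :=
  fun _ hp => conjAt_mem g' hp

theorem twistorMap_leftInvOn : Set.LeftInvOn (g'.twistorMap g) (g.twistorMap g') g.twistorSpace :=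
  fun p hp => congrArg (TotalSpace.mk p.1) (conjAt_conjAt g' hp)

end HermitianMetric

/-! ### Coordinates -/

section Coordinates

variable {x₀ y : M}

theorem continuousLinearEquivAt_I_smul (hy : y ∈ (trivializationAt F E x₀).baseSet) (u : E y) :
    (trivializationAt F E x₀).continuousLinearEquivAt ℝ y hy (Complex.I • u)
      = Complex.I • (trivializationAt F E x₀).continuousLinearEquivAt ℝ y hy u :=
  ((trivializationAt F E x₀).linear ℂ hy).map_smul Complex.I u

theorem endCoord_eq (hy : y ∈ (trivializationAt F E x₀).baseSet) (K : E y →L[ℝ] E y) :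
    (trivializationAt (F →L[ℝ] F) (fun x : M => E x →L[ℝ] E x) x₀ ⟨y, K⟩).2
      = ((trivializationAt F E x₀).continuousLinearEquivAt ℝ y hy).conjContinuousAlgEquiv K := by
  rw [hom_trivializationAt_apply, ContinuousLinearMap.inCoordinates_eq hy hy]
  rfl

theorem conj_fibreJ (hy : y ∈ (trivializationAt F E x₀).baseSet) :
    ((trivializationAt F E x₀).continuousLinearEquivAt ℝ y hy).conjContinuousAlgEquiv (fibreJ E y)
      = Complex.I • ContinuousLinearMap.id ℝ F := by
  ext u
  rw [ContinuousLinearEquiv.conjContinuousAlgEquiv_apply_apply, fibreJ_apply,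
    continuousLinearEquivAt_I_smul, ContinuousLinearEquiv.apply_symm_apply]
  rfl

namespace HermitianMetric

variable (g g' : HermitianMetric H F E)

/-- The Gram matrix of `g` at `y` in the frame around `x₀`. -/
def gram (x₀ y : M) : F →L[ℝ] F →L[ℝ] ℝ :=
  (trivializationAt (F →L[ℝ] F →L[ℝ] ℝ) (fun y => E y →L[ℝ] E y →L[ℝ] ℝ) x₀ ⟨y, g.inner y⟩).2

theorem gram_apply (hy : y ∈ (trivializationAt F E x₀).baseSet) (u w : E y) :
    g.gram x₀ y ((trivializationAt F E x₀).continuousLinearEquivAt ℝ y hy u)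
      ((trivializationAt F E x₀).continuousLinearEquivAt ℝ y hy w) = g.inner y u w := by
  have h : ∀ v : E y, (trivializationAt F E x₀).symm y
      ((trivializationAt F E x₀).continuousLinearEquivAt ℝ y hy v) = v :=
    fun v => ((trivializationAt F E x₀).continuousLinearEquivAt ℝ y hy).symm_apply_apply v
  rw [gram, hom_trivializationAt_apply]
  refine (inCoordinates_apply_eq₂ hy hy (Set.mem_univ _)).trans ?_
  rw [h, h]
  simp

theorem gram_bijective (hy : y ∈ (trivializationAt F E x₀).baseSet) :
    Function.Bijective (g.gram x₀ y) := by
  set e := (trivializationAt F E x₀).continuousLinearEquivAt ℝ y hy with he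
  have h : ∀ u w : F, g.gram x₀ y u w = g.inner y (e.symm u) (e.symm w) := fun u w => by
    rw [← g.gram_apply hy, ← he, e.apply_symm_apply, e.apply_symm_apply]
  constructor
  · rw [injective_iff_map_eq_zero]
    intro u hu
    have : e.symm u = 0 := g.inner_ext fun w => by
      rw [← e.symm_apply_apply w, ← h, hu]; simp
    simpa using this
  · intro φ
    obtain ⟨u, hu⟩ := (g.inner_bijective y).2 (φ.comp (e : E y →L[ℝ] F))
    refine ⟨e u, ContinuousLinearMap.ext fun w => ?_⟩
    rw [h, e.symm_apply_apply, hu]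
    simp

theorem gram_isInvertible (hy : y ∈ (trivializationAt F E x₀).baseSet) :
    (g.gram x₀ y).IsInvertible :=
  ⟨(LinearEquiv.ofBijective (g.gram x₀ y).toLinearMap
    (g.gram_bijective hy)).toContinuousLinearEquiv, rfl⟩

theorem contMDiffAt_gram (x₀ : M) :
    ContMDiffAt 𝓘(ℝ, H) 𝓘(ℝ, F →L[ℝ] F →L[ℝ] ℝ) ∞ (g.gram x₀) x₀ :=
  (contMDiffAt_section x₀).1 (g.contMDiff x₀)

/-- The matrix of `g.comparison g' y` in the frame around `x₀`. -/
def comparisonCoord (x₀ y : M) : F →L[ℝ] F :=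
  (g'.gram x₀ y).inverse.comp (g.gram x₀ y)

theorem gram_comparisonCoord (hy : y ∈ (trivializationAt F E x₀).baseSet) (u : F) :
    g'.gram x₀ y (g.comparisonCoord g' x₀ y u) = g.gram x₀ y u :=
  ((g'.gram_isInvertible hy).inverse_apply_eq.1 rfl).symm

theorem comparisonCoord_eq (hy : y ∈ (trivializationAt F E x₀).baseSet) :
    g.comparisonCoord g' x₀ y =
      ((trivializationAt F E x₀).continuousLinearEquivAt ℝ y hy).conjContinuousAlgEquiv
        (g.comparison g' y) := by
  ext u
  obtain ⟨u, rfl⟩ := ((trivializationAt F E x₀).continuousLinearEquivAt ℝ y hy).surjective u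
  refine (g'.gram_bijective hy).1 (ContinuousLinearMap.ext fun w => ?_)
  obtain ⟨w, rfl⟩ := ((trivializationAt F E x₀).continuousLinearEquivAt ℝ y hy).surjective w
  rw [gram_comparisonCoord g g' hy, ContinuousLinearEquiv.conjContinuousAlgEquiv_apply_apply,
    ContinuousLinearEquiv.symm_apply_apply, gram_apply, gram_apply, inner_comparison]

theorem contMDiffAt_comparisonCoord (x₀ : M) :
    ContMDiffAt 𝓘(ℝ, H) 𝓘(ℝ, F →L[ℝ] F) ∞ (g.comparisonCoord g' x₀) x₀ := by
  have : CompleteSpace F := FiniteDimensional.complete ℂ F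
  have hx := FiberBundle.mem_baseSet_trivializationAt F E x₀
  exact ContMDiffAt.clm_comp (((g'.gram_isInvertible hx).contDiffAt_map_inverse).contMDiffAt.comp x₀
    (g'.contMDiffAt_gram x₀)) (g.contMDiffAt_gram x₀)

end HermitianMetric

end Coordinates

/-! ### Smoothness of the comparison map -/

theorem map_ringInverse {R R' : Type*} [Ring R] [Ring R'] (f : R ≃+* R') (a : R) :
    f (Ring.inverse a) = Ring.inverse (f a) := by
  by_cases h : IsUnit a
  · obtain ⟨u, rfl⟩ := h
    have : f (u : R) = ((Units.map (f : R →* R') u : R'ˣ) : R') := rfl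
    rw [Ring.inverse_unit, this, Ring.inverse_unit]
    rfl
  · rw [Ring.inverse_non_unit _ h, Ring.inverse_non_unit, map_zero]
    exact fun h' => h ((MulEquiv.isUnit_map f).1 h')

variable (F) in
/-- The comparison map in coordinates: `(S, K) ↦ P K P⁻¹`. -/
def conjCoord (q : (F →L[ℝ] F) × (F →L[ℝ] F)) : F →L[ℝ] F :=
  twist (Complex.I • ContinuousLinearMap.id ℝ F) q.1 q.2 * q.2 *
    Ring.inverse (twist (Complex.I • ContinuousLinearMap.id ℝ F) q.1 q.2)

theorem contDiff_twist (J : F →L[ℝ] F) :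
    ContDiff ℝ ∞ fun q : (F →L[ℝ] F) × (F →L[ℝ] F) => twist J q.1 q.2 := by
  unfold twist
  fun_prop

theorem contDiffAt_conjCoord {q : (F →L[ℝ] F) × (F →L[ℝ] F)}
    (hq : IsUnit (twist (Complex.I • ContinuousLinearMap.id ℝ F) q.1 q.2)) :
    ContDiffAt ℝ ∞ (conjCoord F) q := by
  have : CompleteSpace F := FiniteDimensional.complete ℂ F
  obtain ⟨u, hu⟩ := hq
  refine ((contDiff_twist _).contDiffAt.mul contDiffAt_snd).mul ?_
  refine ContDiffAt.comp q (g := Ring.inverse) ?_ (contDiff_twist _).contDiffAt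
  rw [← hu]
  exact contDiffAt_ringInverse ℝ u

namespace HermitianMetric

variable (g g' : HermitianMetric H F E) {x₀ y : M}

theorem conj_twistAt (hy : y ∈ (trivializationAt F E x₀).baseSet) (K : E y →L[ℝ] E y) :
    ((trivializationAt F E x₀).continuousLinearEquivAt ℝ y hy).conjContinuousAlgEquiv
        (g.twistAt g' y K) = twist (Complex.I • ContinuousLinearMap.id ℝ F)
      (g.comparisonCoord g' x₀ y)
      (((trivializationAt F E x₀).continuousLinearEquivAt ℝ y hy).conjContinuousAlgEquiv K) := by
  rw [comparisonCoord_eq g g' hy, ← conj_fibreJ hy, twistAt, twist, twist]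
  simp only [map_add, map_mul, map_sub, map_one]

theorem conj_conjAt (hy : y ∈ (trivializationAt F E x₀).baseSet) (K : E y →L[ℝ] E y) :
    ((trivializationAt F E x₀).continuousLinearEquivAt ℝ y hy).conjContinuousAlgEquiv
        (g.conjAt g' y K) = conjCoord F (g.comparisonCoord g' x₀ y,
      ((trivializationAt F E x₀).continuousLinearEquivAt ℝ y hy).conjContinuousAlgEquiv K) := by
  rw [conjAt, conjCoord, map_mul, map_mul, ← conj_twistAt g g' hy]
  congr 1
  exact map_ringInverse (RingEquivClass.toRingEquiv
    ((trivializationAt F E x₀).continuousLinearEquivAt ℝ y hy).conjContinuousAlgEquiv) _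

end HermitianMetric

section Differential

theorem _root_.HasMFDerivAt.prodMk_space {V W N : Type*} [NormedAddCommGroup V] [NormedSpace ℝ V]
    [NormedAddCommGroup W] [NormedSpace ℝ W] {V' H' : Type*} [NormedAddCommGroup V']
    [NormedSpace ℝ V'] [TopologicalSpace H'] {I : ModelWithCorners ℝ V' H'} [TopologicalSpace N]
    [ChartedSpace H' N] {φ : N → V} {ψ : N → W} {x : N} {φ' : TangentSpace I x →L[ℝ] V}
    {ψ' : TangentSpace I x →L[ℝ] W} (hφ : HasMFDerivAt I 𝓘(ℝ, V) φ x φ')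
    (hψ : HasMFDerivAt I 𝓘(ℝ, W) ψ x ψ') :
    HasMFDerivAt I 𝓘(ℝ, V × W) (fun y => (φ y, ψ y)) x (φ'.prod ψ') :=
  ⟨hφ.1.prodMk hψ.1, hφ.2.prodMk hψ.2⟩

theorem contMDiffAt_endCoord (p : EndSpace F E) :
    ContMDiffAt (endModel H F) 𝓘(ℝ, F →L[ℝ] F) ∞
      (fun q => (trivializationAt (F →L[ℝ] F) (fun x : M => E x →L[ℝ] E x) p.1 q).2) p :=
  (contMDiffAt_totalSpace.1 (contMDiffAt_id (x := p))).2

theorem extChartAt_endSpace (p q : EndSpace F E) :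
    extChartAt (endModel H F) p q = (extChartAt 𝓘(ℝ, H) p.1 q.1,
      (trivializationAt (F →L[ℝ] F) (fun x : M => E x →L[ℝ] E x) p.1 q).2) := by
  rw [FiberBundle.extChartAt]
  rfl

theorem hasMFDerivAt_proj (p : EndSpace F E) :
    HasMFDerivAt (endModel H F) 𝓘(ℝ, H) (fun q : EndSpace F E => q.1) p
      (ContinuousLinearMap.fst ℝ H (F →L[ℝ] F)) := by
  refine ⟨(FiberBundle.continuous_proj _ _).continuousAt, ?_⟩
  refine HasFDerivAt.hasFDerivWithinAt ?_
  refine hasFDerivAt_fst.congr_of_eventuallyEq ?_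
  filter_upwards [extChartAt_target_mem_nhds (I := endModel H F) p] with z hz
  have h := (extChartAt (endModel H F) p).right_inv hz
  rw [extChartAt_endSpace] at h
  exact congrArg Prod.fst h

theorem hasMFDerivAt_endCoord (p : EndSpace F E) :
    HasMFDerivAt (endModel H F) 𝓘(ℝ, F →L[ℝ] F)
      (fun q => (trivializationAt (F →L[ℝ] F) (fun x : M => E x →L[ℝ] E x) p.1 q).2) p
      (ContinuousLinearMap.snd ℝ H (F →L[ℝ] F)) := by
  refine ⟨(contMDiffAt_endCoord (H := H) p).continuousAt, ?_⟩
  refine HasFDerivAt.hasFDerivWithinAt ?_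
  refine hasFDerivAt_snd.congr_of_eventuallyEq ?_
  filter_upwards [extChartAt_target_mem_nhds (I := endModel H F) p] with z hz
  have h := (extChartAt (endModel H F) p).right_inv hz
  rw [extChartAt_endSpace] at h
  exact congrArg Prod.snd h

theorem fderiv_conjCoord {s k : F →L[ℝ] F}
    (h : IsUnit (twist (Complex.I • ContinuousLinearMap.id ℝ F) s k)) (σ A : F →L[ℝ] F) :
    fderiv ℝ (conjCoord F) (s, k) (σ, A) * twist (Complex.I • ContinuousLinearMap.id ℝ F) s k
        + conjCoord F (s, k) * (σ * (1 - (Complex.I • ContinuousLinearMap.id ℝ F) * k)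
          + (1 - s) * (Complex.I • ContinuousLinearMap.id ℝ F) * A)
      = (σ * (1 - (Complex.I • ContinuousLinearMap.id ℝ F) * k)
          + (1 - s) * (Complex.I • ContinuousLinearMap.id ℝ F) * A) * k
        + twist (Complex.I • ContinuousLinearMap.id ℝ F) s k * A := by
  have : CompleteSpace F := FiniteDimensional.complete ℂ F
  have hc := ((contDiffAt_conjCoord (q := (s, k)) h).differentiableAt (by simp)).hasFDerivAt
  set J : F →L[ℝ] F := Complex.I • ContinuousLinearMap.id ℝ F with hJ
  have h1 : HasFDerivAt (fun q : (F →L[ℝ] F) × (F →L[ℝ] F) => q.1)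
      (ContinuousLinearMap.fst ℝ _ _) (s, k) := hasFDerivAt_fst
  have h2 : HasFDerivAt (fun q : (F →L[ℝ] F) × (F →L[ℝ] F) => q.2)
      (ContinuousLinearMap.snd ℝ _ _) (s, k) := hasFDerivAt_snd
  have ht := (h1.const_add 1).add (((h1.const_sub 1).mul_const' J).mul' h2)
  have hl := hc.mul' ht
  have hr := ht.mul' h2
  have hev : (fun q => conjCoord F q * (1 + q.1 + (1 - q.1) * J * q.2)) =ᶠ[𝓝 (s, k)]
      (fun q => (1 + q.1 + (1 - q.1) * J * q.2) * q.2) := by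
    have hu : ∀ᶠ q in 𝓝 (s, k), IsUnit (twist J q.1 q.2) := by
      have hc : ContinuousAt (fun q : (F →L[ℝ] F) × (F →L[ℝ] F) => twist J q.1 q.2) (s, k) :=
        (contDiff_twist J).continuous.continuousAt
      exact hc.preimage_mem_nhds (Units.isOpen.mem_nhds h)
    filter_upwards [hu] with q hq
    rw [conjCoord, ← hJ, ← twist, mul_assoc, Ring.inverse_mul_cancel _ hq, mul_one]
  have := congrArg (fun f => f (σ, A)) (hl.unique (hr.congr_of_eventuallyEq hev))
  change conjCoord F (s, k) * (σ + ((1 - s) * J * A + -σ * J * k))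
      + fderiv ℝ (conjCoord F) (s, k) (σ, A) * (1 + s + (1 - s) * J * k)
    = (1 + s + (1 - s) * J * k) * A + (σ + ((1 - s) * J * A + -σ * J * k)) * k at this
  unfold twist
  linear_combination (norm := noncomm_ring) this

end Differential

namespace HermitianMetric

variable (g g' : HermitianMetric H F E)

theorem isUnit_twist_comparisonCoord {x : M} {K : E x →L[ℝ] E x}
    (h : (⟨x, K⟩ : EndSpace F E) ∈ g.twistorSpace) :
    IsUnit (twist (Complex.I • ContinuousLinearMap.id ℝ F) (g.comparisonCoord g' x x)
      ((frameAt F E x).conjContinuousAlgEquiv K)) := by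
  have := (isUnit_twistAt g' h.1 h.2).map (frameAt F E x).conjContinuousAlgEquiv
  rwa [frameAt, conj_twistAt] at this

theorem endCoord_twistorMap (p : EndSpace F E) :
    (fun q => (trivializationAt (F →L[ℝ] F) (fun x : M => E x →L[ℝ] E x) p.1
        (g.twistorMap g' q)).2) =ᶠ[𝓝 p]
      conjCoord F ∘ fun q : EndSpace F E => (g.comparisonCoord g' p.1 q.1,
        (trivializationAt (F →L[ℝ] F) (fun x : M => E x →L[ℝ] E x) p.1 q).2) := by
  have h : ∀ᶠ q : EndSpace F E in 𝓝 p, q.1 ∈ (trivializationAt F E p.1).baseSet :=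
    (FiberBundle.continuous_proj (F →L[ℝ] F) (fun x : M => E x →L[ℝ] E x)).continuousAt.eventually
      ((trivializationAt F E p.1).open_baseSet.mem_nhds
        (FiberBundle.mem_baseSet_trivializationAt F E p.1))
  filter_upwards [h] with q hq
  rw [twistorMap, endCoord_eq hq, conj_conjAt g g' hq, ← endCoord_eq hq]
  rfl

theorem contMDiffAt_twistorMap {x : M} {K : E x →L[ℝ] E x}
    (h : (⟨x, K⟩ : EndSpace F E) ∈ g.twistorSpace) :
    ContMDiffAt (endModel H F) (endModel H F) ∞ (g.twistorMap g') ⟨x, K⟩ := by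
  refine contMDiffAt_totalSpace.2 ⟨contMDiffAt_proj _, ?_⟩
  refine ContMDiffAt.congr_of_eventuallyEq ?_ (g.endCoord_twistorMap g' ⟨x, K⟩)
  refine ContMDiffAt.comp _ (contDiffAt_conjCoord ?_).contMDiffAt
    (ContMDiffAt.prodMk_space ?_ (contMDiffAt_endCoord _))
  · rw [endCoord_eq (FiberBundle.mem_baseSet_trivializationAt F E x)]
    exact g.isUnit_twist_comparisonCoord g' h
  · exact (g.contMDiffAt_comparisonCoord g' x).comp (⟨x, K⟩ : EndSpace F E) (contMDiffAt_proj _)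

/-- The derivative at `x` of the comparison endomorphism, in the frame around `x`. -/
def comparisonDeriv (x : M) (v : TangentSpace 𝓘(ℝ, H) x) : E x →L[ℝ] E x :=
  (frameAt F E x).symm.conjContinuousAlgEquiv (mvfderiv 𝓘(ℝ, H) (g.comparisonCoord g' x) x v)

theorem exists_hasMFDerivAt_twistorMap {x : M} {K : E x →L[ℝ] E x}
    (h : (⟨x, K⟩ : EndSpace F E) ∈ g.twistorSpace) :
    ∃ L : TangentSpace (endModel H F) (⟨x, K⟩ : EndSpace F E) →L[ℝ]
        TangentSpace (endModel H F) (g.twistorMap g' ⟨x, K⟩),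
      HasMFDerivAt (endModel H F) (endModel H F) (g.twistorMap g') ⟨x, K⟩ L ∧ ∀ X,
        basePart (g.twistorMap g' ⟨x, K⟩) (L X) = basePart ⟨x, K⟩ X ∧
        ∃ A B σ : E x →L[ℝ] E x, A = fibrePart ⟨x, K⟩ X ∧
          B = fibrePart (g.twistorMap g' ⟨x, K⟩) (L X) ∧
          σ = g.comparisonDeriv g' x (basePart ⟨x, K⟩ X) ∧
          B * g.twistAt g' x K + g.conjAt g' x K * (σ * (1 - fibreJ E x * K)
            + (1 - g.comparison g' x) * fibreJ E x * A)
          = (σ * (1 - fibreJ E x * K) + (1 - g.comparison g' x) * fibreJ E x * A) * K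
            + g.twistAt g' x K * A := by
  have hx := FiberBundle.mem_baseSet_trivializationAt F E x
  have hd := ((g.contMDiffAt_twistorMap g' h).mdifferentiableAt (by simp)).hasMFDerivAt
  set p : EndSpace F E := ⟨x, K⟩ with hp
  refine ⟨_, hd, fun X => ?_⟩
  set L := mfderiv (endModel H F) (endModel H F) (g.twistorMap g') p
  have hbase := hasMFDerivAt_unique ((hasMFDerivAt_proj (g.twistorMap g' p)).comp p hd)
    (hasMFDerivAt_proj p)
  have hS : HasMFDerivAt 𝓘(ℝ, H) 𝓘(ℝ, F →L[ℝ] F) (g.comparisonCoord g' x) x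
      (mfderiv 𝓘(ℝ, H) 𝓘(ℝ, F →L[ℝ] F) (g.comparisonCoord g' x) x) :=
    ((g.contMDiffAt_comparisonCoord g' x).mdifferentiableAt (by simp)).hasMFDerivAt
  have hK : (trivializationAt (F →L[ℝ] F) (fun x : M => E x →L[ℝ] E x) x p).2
      = (frameAt F E x).conjContinuousAlgEquiv K := endCoord_eq hx K
  have hunit := g.isUnit_twist_comparisonCoord g' h
  have hc : HasFDerivAt (conjCoord F) (fderiv ℝ (conjCoord F) (g.comparisonCoord g' x x,
      (frameAt F E x).conjContinuousAlgEquiv K)) (g.comparisonCoord g' x x,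
      (trivializationAt (F →L[ℝ] F) (fun x : M => E x →L[ℝ] E x) x p).2) := by
    rw [hK]
    exact ((contDiffAt_conjCoord hunit).differentiableAt (by simp)).hasFDerivAt
  have hpair := HasMFDerivAt.prodMk_space (hS.comp p (hasMFDerivAt_proj p))
    (hasMFDerivAt_endCoord p)
  have hcoord := hasMFDerivAt_unique ((hasMFDerivAt_endCoord (g.twistorMap g' p)).comp p hd)
    ((hc.hasMFDerivAt.comp p hpair).congr_of_eventuallyEq (g.endCoord_twistorMap g' p))
  have hrel := fderiv_conjCoord hunit
    (mvfderiv 𝓘(ℝ, H) (g.comparisonCoord g' x) x (basePart p X)) (show H × (F →L[ℝ] F) from X).2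
  have hLX : (show H × (F →L[ℝ] F) from L X).2 = fderiv ℝ (conjCoord F) (g.comparisonCoord g' x x,
      (frameAt F E x).conjContinuousAlgEquiv K)
      (mvfderiv 𝓘(ℝ, H) (g.comparisonCoord g' x) x (basePart p X),
        (show H × (F →L[ℝ] F) from X).2) := congrArg (fun f => f X) hcoord
  refine ⟨congrArg (fun f => f X) hbase, _, _, _, rfl, rfl, rfl, ?_⟩
  have hA : fibrePart p X
      = (frameAt F E x).symm.conjContinuousAlgEquiv (show H × (F →L[ℝ] F) from X).2 := rfl
  have hB : fibrePart (g.twistorMap g' p) (L X)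
      = (frameAt F E x).symm.conjContinuousAlgEquiv (show H × (F →L[ℝ] F) from L X).2 := rfl
  have hinv : ∀ T : F →L[ℝ] F, (frameAt F E x).conjContinuousAlgEquiv
      ((frameAt F E x).symm.conjContinuousAlgEquiv T) = T := fun T =>
    (frameAt F E x).conjContinuousAlgEquiv.apply_symm_apply T
  have e1 : (frameAt F E x).conjContinuousAlgEquiv (g.twistAt g' x K) = _ := conj_twistAt g g' hx K
  have e2 : (frameAt F E x).conjContinuousAlgEquiv (g.conjAt g' x K) = _ := conj_conjAt g g' hx K
  have e3 : (frameAt F E x).conjContinuousAlgEquiv (fibreJ E x) = _ := conj_fibreJ hx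
  have e4 : g.comparisonCoord g' x x = (frameAt F E x).conjContinuousAlgEquiv _ :=
    g.comparisonCoord_eq g' hx
  rw [hA, hB, hLX, comparisonDeriv]
  generalize (show H × (F →L[ℝ] F) from X).2 = A at *
  generalize mvfderiv 𝓘(ℝ, H) (g.comparisonCoord g' x) x (basePart p X) = σ at *
  generalize fderiv ℝ (conjCoord F) (g.comparisonCoord g' x x,
    (frameAt F E x).conjContinuousAlgEquiv K) (σ, A) = B at *
  refine (frameAt F E x).conjContinuousAlgEquiv.injective
    (show (frameAt F E x).conjContinuousAlgEquiv _ = (frameAt F E x).conjContinuousAlgEquiv _ from ?_)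
  simp only [map_add, map_mul, map_sub, map_one, hinv]
  rw [e1, e2, e3, ← e4]
  exact hrel

end HermitianMetric

/-! ### Tangent vectors of twistor spaces and the almost complex structures -/

theorem endSpace_tangent_ext {p : EndSpace F E} {X Y : TangentSpace (endModel H F) p}
    (h : basePart p X = basePart p Y) (h' : fibrePart p X = fibrePart p Y) : X = Y :=
  Prod.ext h ((frameAt F E p.1).symm.conjContinuousAlgEquiv.injective h')

theorem basePart_twistorJ (cov : CovariantDerivative 𝓘(ℝ, H) F E) (p : EndSpace F E)
    (X : TangentSpace (endModel H F) p) :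
    basePart p (twistorJ cov p X) = tangentI p.1 (basePart p X) :=
  zero_add (show H from tangentI p.1 (basePart p X))

theorem fibrePart_twistorJ (cov : CovariantDerivative 𝓘(ℝ, H) F E) (x : M) (K : E x →L[ℝ] E x)
    (X : TangentSpace (endModel H F) (⟨x, K⟩ : EndSpace F E)) :
    fibrePart ⟨x, K⟩ (twistorJ cov ⟨x, K⟩ X) =
      K * (fibrePart ⟨x, K⟩ X + (connectionForm cov x (basePart ⟨x, K⟩ X) * K
          - K * connectionForm cov x (basePart ⟨x, K⟩ X)))
        - (connectionForm cov x (tangentI x (basePart ⟨x, K⟩ X)) * K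
          - K * connectionForm cov x (tangentI x (basePart ⟨x, K⟩ X))) := by
  have h : ∀ A B : E x →L[ℝ] E x, (frameAt F E x).symm.conjContinuousAlgEquiv
      ((frameAt F E x).conjContinuousAlgEquiv A + (frameAt F E x).conjContinuousAlgEquiv (-B))
        = A - B := fun A B => by
    rw [← map_add, ← sub_eq_add_neg]
    exact (frameAt F E x).conjContinuousAlgEquiv.symm_apply_apply _
  exact h (K * verticalPart cov ⟨x, K⟩ X)
    (endConnectionForm cov x (tangentI x (basePart ⟨x, K⟩ X)) K)

theorem fibrePart_anticomm (g : HermitianMetric H F E) {x : M} {K : E x →L[ℝ] E x}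
    {X : TangentSpace (endModel H F) (⟨x, K⟩ : EndSpace F E)}
    (hX : X ∈ tangentVectors g.twistorSpace ⟨x, K⟩) :
    fibrePart ⟨x, K⟩ X * K + K * fibrePart ⟨x, K⟩ X = 0 := by
  obtain ⟨c, hc, hcS, h0⟩ := hX
  injection h0 with hc0 hXc
  have hx := FiberBundle.mem_baseSet_trivializationAt F E x
  have hd := ((hc 0).mdifferentiableAt (by simp)).hasMFDerivAt
  set κ : EndSpace F E → (F →L[ℝ] F) :=
    fun q => (trivializationAt (F →L[ℝ] F) (fun x : M => E x →L[ℝ] E x) x q).2 with hκ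
  have hκd : HasDerivAt (κ ∘ c) (show H × (F →L[ℝ] F) from X).2 0 := by
    have hp : HasMFDerivAt (endModel H F) 𝓘(ℝ, F →L[ℝ] F) κ (c 0)
        (ContinuousLinearMap.snd ℝ H (F →L[ℝ] F)) := by
      rw [hc0]; exact hasMFDerivAt_endCoord ⟨x, K⟩
    rw [← hXc]
    have hcomp : HasFDerivAt (κ ∘ c) ((ContinuousLinearMap.snd ℝ H (F →L[ℝ] F)).comp
        (show ℝ →L[ℝ] H × (F →L[ℝ] F) from mfderiv 𝓘(ℝ, ℝ) (endModel H F) c 0)) 0 :=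
      (hp.comp 0 hd).hasFDerivAt
    exact hcomp.hasDerivAt
  have hsq : (fun t => κ (c t) * κ (c t)) =ᶠ[𝓝 0] fun _ => -1 := by
    have h : ∀ᶠ t in 𝓝 (0 : ℝ), (c t).1 ∈ (trivializationAt F E x).baseSet := by
      refine ((FiberBundle.continuous_proj _ _).comp hc.continuous).continuousAt.eventually
        ((trivializationAt F E x).open_baseSet.mem_nhds ?_)
      rw [Function.comp_apply, hc0]
      exact hx
    filter_upwards [h] with t ht
    have h2 : (c t).2 * (c t).2 = -1 := HermitianMetric.mul_self_of_mem_twistorSpace (hcS t)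
    have h3 : κ (c t) = ((trivializationAt F E x).continuousLinearEquivAt ℝ (c t).1
      ht).conjContinuousAlgEquiv (c t).2 := endCoord_eq ht (c t).2
    rw [h3, ← map_mul, h2, map_neg, map_one]
  have h := (hκd.mul hκd).unique ((hasDerivAt_const 0 (-1)).congr_of_eventuallyEq hsq)
  have hκ0 : κ (c 0) = (frameAt F E x).conjContinuousAlgEquiv K := by
    rw [hc0]; exact endCoord_eq hx K
  rw [Function.comp_apply, hκ0] at h
  have h' := congrArg (frameAt F E x).symm.conjContinuousAlgEquiv h
  have hinv : (frameAt F E x).symm.conjContinuousAlgEquiv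
      ((frameAt F E x).conjContinuousAlgEquiv K) = K :=
    (frameAt F E x).conjContinuousAlgEquiv.symm_apply_apply K
  rw [map_add, map_mul, map_mul, hinv, map_zero] at h'
  exact h'

/-- The comparison map is a biholomorphism as soon as the connection forms `θ`, `θ'` and the
derivative `σ` of the comparison endomorphism satisfy `N(I v) = -N(v) K`, where
`N(v) = σ(v)(1 - JK) - (1 - S)J[θ(v), K] - Pθ(v) + θ'(v)P`. -/
theorem fibrewiseBiholomorphic_of_defect (g g' : HermitianMetric H F E)
    (cov cov' : CovariantDerivative 𝓘(ℝ, H) F E)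
    (h : ∀ (x : M) (K : E x →L[ℝ] E x) (v : TangentSpace 𝓘(ℝ, H) x), K * K = -1 →
      g.comparisonDeriv g' x (tangentI x v) * (1 - fibreJ E x * K)
          - (1 - g.comparison g' x) * fibreJ E x *
            (connectionForm cov x (tangentI x v) * K - K * connectionForm cov x (tangentI x v))
          - g.twistAt g' x K * connectionForm cov x (tangentI x v)
          + connectionForm cov' x (tangentI x v) * g.twistAt g' x K
        = -(g.comparisonDeriv g' x v * (1 - fibreJ E x * K)
          - (1 - g.comparison g' x) * fibreJ E x *
            (connectionForm cov x v * K - K * connectionForm cov x v)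
          - g.twistAt g' x K * connectionForm cov x v
          + connectionForm cov' x v * g.twistAt g' x K) * K) :
    FibrewiseBiholomorphic g.twistorSpace (twistorJ cov) g'.twistorSpace (twistorJ cov') := by
  refine ⟨g.twistorMap g', g'.twistorMap g, HermitianMetric.twistorMap_mapsTo g',
    HermitianMetric.twistorMap_mapsTo g, HermitianMetric.twistorMap_leftInvOn g',
    HermitianMetric.twistorMap_leftInvOn g, fun _ _ => rfl,
    fun p hp => (g.contMDiffAt_twistorMap g' hp).contMDiffWithinAt,
    fun p hp => (g'.contMDiffAt_twistorMap g hp).contMDiffWithinAt, ?_⟩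
  rintro ⟨x, K⟩ hp
  obtain ⟨L, hL, hrel⟩ := g.exists_hasMFDerivAt_twistorMap g' hp
  refine ⟨L, hL.hasMFDerivWithinAt, fun X hX => ?_⟩
  obtain ⟨hb, A, B, σ, rfl, hB, rfl, hAB⟩ := hrel X
  obtain ⟨hb₂, A₂, B₂, σ₂, hA₂, hB₂, hσ₂, hAB₂⟩ := hrel (twistorJ cov ⟨x, K⟩ X)
  have hbJ : basePart ⟨x, K⟩ (twistorJ cov ⟨x, K⟩ X) = tangentI x (basePart ⟨x, K⟩ X) :=
    basePart_twistorJ cov ⟨x, K⟩ X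
  have hK := HermitianMetric.mul_self_of_mem_twistorSpace hp
  have key := intertwines_of_twist hK (HermitianMetric.twistAt_mul_inverse g' hp)
    (HermitianMetric.conjAt_mul_twistAt g' hp) (fibrePart_anticomm g hX)
    (hA₂.trans (fibrePart_twistorJ cov x K X)) hAB hAB₂
    (by rw [hσ₂, hbJ]; exact h x K _ hK)
  refine endSpace_tangent_ext ?_ ?_
  · rw [hb₂, basePart_twistorJ, basePart_twistorJ, hb]
    rfl
  · have e := fibrePart_twistorJ cov' x (g.conjAt g' x K) (L X)
    have hb' : basePart (⟨x, g.conjAt g' x K⟩ : EndSpace F E) (L X) = basePart ⟨x, K⟩ X := hb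
    have hB' : B = fibrePart (⟨x, g.conjAt g' x K⟩ : EndSpace F E) (L X) := hB
    rw [hb', ← hB'] at e
    exact hB₂.symm.trans (key.trans e.symm)

/-! ### Connection forms -/

section ConnectionForms

variable (g g' : HermitianMetric H F E) (D : SkewForm H F E) (x : M)

theorem constantSection_self (u : E x) : constantSection F u x = u := by
  rw [constantSection,
    Trivialization.symmL_apply _ (FiberBundle.mem_baseSet_trivializationAt F E x)]
  exact (frameAt F E x).symm_apply_apply u

theorem frameDerivative_constantSection (u : E x) :
    frameDerivative H F E (constantSection F u) x = 0 := by
  have h : (fun y => (trivializationAt F E x ⟨y, constantSection F u y⟩).2) =ᶠ[𝓝 x]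
      fun _ => frameAt F E x u := by
    filter_upwards [(trivializationAt F E x).open_baseSet.mem_nhds
      (FiberBundle.mem_baseSet_trivializationAt F E x)] with y hy
    rw [constantSection, Trivialization.symmL_apply _ hy, Trivialization.apply_mk_symm _ hy]
  have h' : mvfderiv 𝓘(ℝ, H) (fun y => (trivializationAt F E x ⟨y, constantSection F u y⟩).2) x
      = 0 := by
    rw [mvfderiv_congr_of_eventuallyEq h]
    exact mvfderiv_const _
  change ((frameAt F E x).symm : F →L[ℝ] E x).comp (mvfderiv 𝓘(ℝ, H)
    (fun y => (trivializationAt F E x ⟨y, constantSection F u y⟩).2) x) = 0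
  rw [h', ContinuousLinearMap.comp_zero]

theorem connectionForm_chernConnection (v : TangentSpace 𝓘(ℝ, H) x) (u : E x) :
    connectionForm g.chernConnection x v u = g.chernForm x u v := by
  change (frameDerivative H F E (constantSection F u) x
    + formAt F x (g.chernForm x) (constantSection F u x)) v = _
  rw [frameDerivative_constantSection, constantSection_self, zero_add]
  rfl

theorem connectionForm_connection (v : TangentSpace 𝓘(ℝ, H) x) (u : E x) :
    connectionForm (g.connection D) x v u
      = connectionForm g.chernConnection x v u + D.realForm g x u v := by
  change (g.chernConnection (constantSection F u) x
    + formAt F x (D.realForm g x) (constantSection F u x)) v = _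
  rw [constantSection_self]
  rfl

end ConnectionForms

section Bilinear

variable {V W N V' H' : Type*} [NormedAddCommGroup V] [NormedSpace ℝ V] [NormedAddCommGroup W]
  [NormedSpace ℝ W] [NormedAddCommGroup V']
  [NormedSpace ℝ V'] [TopologicalSpace H'] {I : ModelWithCorners ℝ V' H'} [TopologicalSpace N]
  [ChartedSpace H' N] {x : N}

theorem hasMFDerivAt_clm_apply {A : N → V →L[ℝ] W} {s : N → V}
    {A' : TangentSpace I x →L[ℝ] V →L[ℝ] W} {s' : TangentSpace I x →L[ℝ] V}
    (hA : HasMFDerivAt I 𝓘(ℝ, V →L[ℝ] W) A x A') (hs : HasMFDerivAt I 𝓘(ℝ, V) s x s') :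
    ∃ L : TangentSpace I x →L[ℝ] W, HasMFDerivAt I 𝓘(ℝ, W) (fun y => A y (s y)) x L ∧
      ∀ v, L v = A' v (s x) + A x (s' v) := by
  have h := (isBoundedBilinearMap_apply (𝕜 := ℝ) (E := V) (F := W)).hasFDerivAt (A x, s x)
  exact ⟨_, h.hasMFDerivAt.comp x (hA.prodMk_space hs), fun v => add_comm _ _⟩

variable {G : N → V →L[ℝ] V →L[ℝ] ℝ} {s : N → V →L[ℝ] V}
  {G' : TangentSpace I x →L[ℝ] V →L[ℝ] V →L[ℝ] ℝ} {s' : TangentSpace I x →L[ℝ] V →L[ℝ] V}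

theorem hasMFDerivAt_bilin_comp (hG : HasMFDerivAt I 𝓘(ℝ, V →L[ℝ] V →L[ℝ] ℝ) G x G')
    (hs : HasMFDerivAt I 𝓘(ℝ, V →L[ℝ] V) s x s') (a b : V) :
    ∃ L : TangentSpace I x →L[ℝ] ℝ, HasMFDerivAt I 𝓘(ℝ, ℝ) (fun y => G y (s y a) b) x L ∧
      ∀ v, L v = G' v (s x a) b + G x (s' v a) b := by
  obtain ⟨L₁, h₁, e₁⟩ := hasMFDerivAt_clm_apply hs (hasMFDerivAt_const a x)
  obtain ⟨L₂, h₂, e₂⟩ := hasMFDerivAt_clm_apply hG h₁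
  obtain ⟨L₃, h₃, e₃⟩ := hasMFDerivAt_clm_apply h₂ (hasMFDerivAt_const b x)
  refine ⟨L₃, h₃, fun v => ?_⟩
  rw [e₃, e₂, e₁]
  change (G' v (s x a) + G x (s' v a + s x 0)) b + G x (s x a) 0 = _
  simp

theorem hasMFDerivAt_bilin (hG : HasMFDerivAt I 𝓘(ℝ, V →L[ℝ] V →L[ℝ] ℝ) G x G') (a b : V) :
    ∃ L : TangentSpace I x →L[ℝ] ℝ, HasMFDerivAt I 𝓘(ℝ, ℝ) (fun y => G y a b) x L ∧
      ∀ v, L v = G' v a b := by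
  obtain ⟨L, hL, h⟩ := hasMFDerivAt_bilin_comp hG (hasMFDerivAt_const (1 : V →L[ℝ] V) x) a b
  refine ⟨L, hL, fun v => (h v).trans ?_⟩
  change G' v a b + G x 0 b = _
  simp

end Bilinear

theorem tangentI_tangentI (x : M) (v : TangentSpace 𝓘(ℝ, H) x) : tangentI x (tangentI x v) = -v := by
  change Complex.I • Complex.I • (show H from v) = -(show H from v)
  rw [smul_smul, Complex.I_mul_I, neg_one_smul]

namespace HermitianMetric

variable (g g' : HermitianMetric H F E) {x : M}

theorem hasMFDerivAt_gram (x : M) :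
    HasMFDerivAt 𝓘(ℝ, H) 𝓘(ℝ, F →L[ℝ] F →L[ℝ] ℝ) (g.gram x) x (g.gramDeriv x) :=
  ((g.contMDiffAt_gram x).mdifferentiableAt (by simp)).hasMFDerivAt

theorem hasMFDerivAt_comparisonCoord (x : M) :
    HasMFDerivAt 𝓘(ℝ, H) 𝓘(ℝ, F →L[ℝ] F) (g.comparisonCoord g' x) x
      (mvfderiv 𝓘(ℝ, H) (g.comparisonCoord g' x) x) :=
  ((g.contMDiffAt_comparisonCoord g' x).mdifferentiableAt (by simp)).hasMFDerivAt

theorem gramDeriv_congr {a b a' b' : F}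
    (h : ∀ y ∈ (trivializationAt F E x).baseSet, g.gram x y a b = g.gram x y a' b')
    (v : TangentSpace 𝓘(ℝ, H) x) : g.gramDeriv x v a b = g.gramDeriv x v a' b' := by
  obtain ⟨L, hL, hLv⟩ := hasMFDerivAt_bilin (g.hasMFDerivAt_gram x) a b
  obtain ⟨L', hL', hLv'⟩ := hasMFDerivAt_bilin (g.hasMFDerivAt_gram x) a' b'
  have h0 : (fun y => g.gram x y a b) =ᶠ[𝓝 x] fun y => g.gram x y a' b' := by
    filter_upwards [(trivializationAt F E x).open_baseSet.mem_nhds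
      (FiberBundle.mem_baseSet_trivializationAt F E x)] with y hy
    exact h y hy
  rw [← hLv, ← hLv', hasMFDerivAt_unique hL (hL'.congr_of_eventuallyEq h0)]

/-- The derivative of the Gram matrix of `g`, as a bilinear form on the fibre. -/
def metricDeriv (x : M) (v : TangentSpace 𝓘(ℝ, H) x) (u w : E x) : ℝ :=
  g.gramDeriv x v (frameAt F E x u) (frameAt F E x w)

theorem metricDeriv_symm (v : TangentSpace 𝓘(ℝ, H) x) (u w : E x) :
    g.metricDeriv x v u w = g.metricDeriv x v w u := by
  refine g.gramDeriv_congr (fun y hy => ?_) v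
  obtain ⟨a, ha⟩ := ((trivializationAt F E x).continuousLinearEquivAt ℝ y hy).surjective
    (frameAt F E x u)
  obtain ⟨b, hb⟩ := ((trivializationAt F E x).continuousLinearEquivAt ℝ y hy).surjective
    (frameAt F E x w)
  rw [← ha, ← hb, gram_apply, gram_apply, g.symm]

theorem metricDeriv_I_I (v : TangentSpace 𝓘(ℝ, H) x) (u w : E x) :
    g.metricDeriv x v (Complex.I • u) (Complex.I • w) = g.metricDeriv x v u w := by
  refine g.gramDeriv_congr (fun y hy => ?_) v
  have hI : ∀ u : E x, frameAt F E x (Complex.I • u) = Complex.I • frameAt F E x u :=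
    continuousLinearEquivAt_I_smul _
  obtain ⟨a, ha⟩ := ((trivializationAt F E x).continuousLinearEquivAt ℝ y hy).surjective
    (frameAt F E x u)
  obtain ⟨b, hb⟩ := ((trivializationAt F E x).continuousLinearEquivAt ℝ y hy).surjective
    (frameAt F E x w)
  rw [hI, hI, ← ha, ← hb, ← continuousLinearEquivAt_I_smul, ← continuousLinearEquivAt_I_smul,
    gram_apply, gram_apply, g.compatible]

theorem metricDeriv_I_left (v : TangentSpace 𝓘(ℝ, H) x) (u w : E x) :
    g.metricDeriv x v (Complex.I • u) w = -g.metricDeriv x v u (Complex.I • w) := by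
  have h := g.metricDeriv_I_I v u (Complex.I • w)
  rw [smul_smul, Complex.I_mul_I, neg_one_smul] at h
  rw [← h]
  simp [metricDeriv]

theorem metricDeriv_tangentI_tangentI (v : TangentSpace 𝓘(ℝ, H) x) (u w : E x) :
    g.metricDeriv x (tangentI x (tangentI x v)) u w = -g.metricDeriv x v u w := by
  rw [tangentI_tangentI, ← neg_one_smul ℝ v, metricDeriv, (g.gramDeriv x).map_smul]
  exact neg_one_mul _

theorem metricDeriv_comparison (v : TangentSpace 𝓘(ℝ, H) x) (u w : E x) :
    g'.metricDeriv x v (g.comparison g' x u) w + g'.inner x (g.comparisonDeriv g' x v u) w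
      = g.metricDeriv x v u w := by
  have hx := FiberBundle.mem_baseSet_trivializationAt F E x
  set a := frameAt F E x u with ha
  set b := frameAt F E x w with hb
  obtain ⟨L, hL, hLv⟩ := hasMFDerivAt_bilin (g.hasMFDerivAt_gram x) a b
  obtain ⟨L', hL', hLv'⟩ := hasMFDerivAt_bilin_comp (g'.hasMFDerivAt_gram x)
    (g.hasMFDerivAt_comparisonCoord g' x) a b
  have h0 : (fun y => g.gram x y a b)
      =ᶠ[𝓝 x] fun y => g'.gram x y (g.comparisonCoord g' x y a) b := by
    filter_upwards [(trivializationAt F E x).open_baseSet.mem_nhds hx] with y hy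
    rw [gram_comparisonCoord g g' hy]
  have h1 := hLv' v
  rw [← hasMFDerivAt_unique hL (hL'.congr_of_eventuallyEq h0), hLv] at h1
  have e1 : g.comparisonCoord g' x x a = frameAt F E x (g.comparison g' x u) := by
    rw [comparisonCoord_eq g g' hx, ha]
    exact congrArg (fun z => frameAt F E x (g.comparison g' x z))
      ((frameAt F E x).symm_apply_apply u)
  have e2 : mvfderiv 𝓘(ℝ, H) (g.comparisonCoord g' x) x v a
      = frameAt F E x (g.comparisonDeriv g' x v u) :=
    ((frameAt F E x).apply_symm_apply _).symm
  rw [e1, e2] at h1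
  refine Eq.trans ?_ h1.symm
  rw [metricDeriv]
  congr 1
  exact (g'.gram_apply hx _ _).symm

theorem inner_chern (v : TangentSpace 𝓘(ℝ, H) x) (u w : E x) :
    g.inner x (connectionForm g.chernConnection x v u) w
      = (g.metricDeriv x v u w + g.metricDeriv x (tangentI x v) u (Complex.I • w)) / 2 := by
  rw [connectionForm_chernConnection]
  refine (g.inner_toRealDual_symm x (g.chernFunctional x u v) w).trans ?_
  change (1 / 2 : ℝ) * (g.metricDeriv x v u w + g.metricDeriv x (tangentI x v) u (Complex.I • w)) = _
  ring

theorem metricDeriv_eq (v : TangentSpace 𝓘(ℝ, H) x) (u w : E x) :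
    g.metricDeriv x v u w = g.inner x (connectionForm g.chernConnection x v u) w
      + g.inner x u (connectionForm g.chernConnection x v w) := by
  rw [g.symm x u, inner_chern, inner_chern, g.metricDeriv_symm v w u,
    g.metricDeriv_symm _ w (Complex.I • u), metricDeriv_I_left]
  ring

theorem chern_comm (v : TangentSpace 𝓘(ℝ, H) x) :
    fibreJ E x * connectionForm g.chernConnection x v
      = connectionForm g.chernConnection x v * fibreJ E x := by
  ext u
  refine g.inner_ext fun w => ?_
  change g.inner x (Complex.I • connectionForm g.chernConnection x v u) w
    = g.inner x (connectionForm g.chernConnection x v (Complex.I • u)) w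
  rw [inner_I_left, inner_chern, inner_chern, metricDeriv_I_left, metricDeriv_I_I, smul_smul,
    Complex.I_mul_I, neg_one_smul]
  simp only [metricDeriv, map_neg]
  ring

theorem chern_tangentI (v : TangentSpace 𝓘(ℝ, H) x) :
    connectionForm g.chernConnection x (tangentI x v)
      = fibreJ E x * connectionForm g.chernConnection x v := by
  ext u
  refine g.inner_ext fun w => ?_
  change _ = g.inner x (Complex.I • connectionForm g.chernConnection x v u) w
  rw [inner_I_left, inner_chern, inner_chern, metricDeriv_tangentI_tangentI, smul_smul,
    Complex.I_mul_I, neg_one_smul]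
  simp only [metricDeriv, map_neg]
  ring

/-- The part of the derivative of the comparison endomorphism `S` that is not accounted for by the
Chern connection forms `c`, `c'`: the endomorphism `ζ` with `dS = S c - c' S + ζ`. -/
def comparisonDefect (x : M) (v : TangentSpace 𝓘(ℝ, H) x) : E x →L[ℝ] E x :=
  g.comparisonDeriv g' x v - g.comparison g' x * connectionForm g.chernConnection x v
    + connectionForm g'.chernConnection x v * g.comparison g' x

theorem inner_comparisonDefect (v : TangentSpace 𝓘(ℝ, H) x) (u w : E x) :
    g'.inner x (g.comparisonDefect g' x v u) w
      = g.inner x u (connectionForm g.chernConnection x v w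
        - connectionForm g'.chernConnection x v w) := by
  have h := g.metricDeriv_comparison g' v u w
  rw [metricDeriv_eq, metricDeriv_eq, inner_comparison] at h
  change g'.inner x (g.comparisonDeriv g' x v u
    - g.comparison g' x (connectionForm g.chernConnection x v u)
    + connectionForm g'.chernConnection x v (g.comparison g' x u)) w = _
  rw [map_add, map_sub, map_sub, add_apply, sub_apply, inner_comparison]
  linarith

theorem chern_I (v : TangentSpace 𝓘(ℝ, H) x) (u : E x) :
    connectionForm g.chernConnection x v (Complex.I • u)
      = Complex.I • connectionForm g.chernConnection x v u :=
  (congrArg (fun f : E x →L[ℝ] E x => f u) (g.chern_comm v)).symm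

theorem comparisonDefect_comm (v : TangentSpace 𝓘(ℝ, H) x) :
    fibreJ E x * g.comparisonDefect g' x v = g.comparisonDefect g' x v * fibreJ E x := by
  ext u
  refine g'.inner_ext fun w => ?_
  change g'.inner x (Complex.I • g.comparisonDefect g' x v u) w
    = g'.inner x (g.comparisonDefect g' x v (Complex.I • u)) w
  rw [inner_I_left, inner_comparisonDefect, inner_comparisonDefect, inner_I_left, chern_I, chern_I,
    smul_sub]

theorem comparisonDefect_tangentI (v : TangentSpace 𝓘(ℝ, H) x) :
    g.comparisonDefect g' x (tangentI x v) = -(fibreJ E x * g.comparisonDefect g' x v) := by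
  ext u
  refine g'.inner_ext fun w => ?_
  change _ = g'.inner x (-(Complex.I • g.comparisonDefect g' x v u)) w
  rw [map_neg, neg_apply, inner_I_left, neg_neg, inner_comparisonDefect,
    inner_comparisonDefect, chern_tangentI, chern_tangentI, chern_I, chern_I]
  rfl

end HermitianMetric

/-! ### The forms `𝒟_g` -/

namespace HermitianMetric

variable (g g' : HermitianMetric H F E) {x : M}

theorem flat_I (u : E x) : g.flat x (Complex.I • u) = -(Complex.I • g.flat x u) := by
  ext w
  have h := g.compatible x u w
  change ((g.inner x (Complex.I • u) w : ℂ)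
      - Complex.I * (g.inner x (Complex.I • u) (Complex.I • w) : ℂ)) / 2
    = -(Complex.I * (((g.inner x u w : ℂ) - Complex.I * (g.inner x u (Complex.I • w) : ℂ)) / 2))
  rw [h, inner_I_left]
  push_cast
  linear_combination (-(g.inner x u (Complex.I • w) : ℂ) / 2) * Complex.I_sq

theorem flat_sharp (μ : DualFiber E x) : g.flat x (g.sharp x μ) = μ := by
  ext w
  have h : ∀ w, g.inner x (g.sharp x μ) w = 2 * (μ w : ℂ).re := fun w => by
    rw [sharp, map_smul]
    exact congrArg (2 * ·) (g.inner_toRealDual_symm x _ w)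
  change ((g.inner x (g.sharp x μ) w : ℂ)
      - Complex.I * (g.inner x (g.sharp x μ) (Complex.I • w) : ℂ)) / 2 = (μ w : ℂ)
  have hI : (μ (Complex.I • w) : ℂ) = Complex.I * (μ w : ℂ) := μ.map_smul Complex.I w
  rw [h, h, hI, Complex.I_mul_re]
  conv_rhs => rw [← Complex.re_add_im (μ w : ℂ)]
  push_cast
  ring

/-- `flat` as a real linear map. -/
def flatLinear (x : M) : E x →ₗ[ℝ] DualFiber E x where
  toFun := g.flat x
  map_add' := g.flat_add x
  map_smul' := g.flat_smul x

/-- `sharp` as a real linear map. -/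
def sharpLinear (x : M) : DualFiber E x →ₗ[ℝ] E x where
  toFun := g.sharp x
  map_add' := g.sharp_add x
  map_smul' := g.sharp_smul x

theorem sharp_I (μ : DualFiber E x) : g.sharp x (Complex.I • μ) = -(Complex.I • g.sharp x μ) := by
  have h : Complex.I • μ = g.flat x (-(Complex.I • g.sharp x μ)) := by
    have hneg : g.flat x (-(Complex.I • g.sharp x μ)) = -g.flat x (Complex.I • g.sharp x μ) :=
      (g.flatLinear x).map_neg _
    rw [hneg, flat_I, flat_sharp, neg_neg]
  rw [h, sharp_flat]

theorem flat_comparison (u : E x) : g'.flat x (g.comparison g' x u) = g.flat x u := by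
  ext w
  change ((g'.inner x _ w : ℂ) - Complex.I * (g'.inner x _ (Complex.I • w) : ℂ)) / 2
    = ((g.inner x u w : ℂ) - Complex.I * (g.inner x u (Complex.I • w) : ℂ)) / 2
  rw [inner_comparison, inner_comparison]

theorem sharp_eq_comparison (μ : DualFiber E x) :
    g'.sharp x μ = g.comparison g' x (g.sharp x μ) := by
  rw [← g'.sharp_flat x (g.comparison g' x _), flat_comparison, flat_sharp]

end HermitianMetric

/-- A real linear endomorphism of a fibre, as a continuous linear map. -/
def fibreEnd (F : Type*) [NormedAddCommGroup F] [NormedSpace ℂ F] [FiniteDimensional ℂ F]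
    {E : M → Type*} [TopologicalSpace (TotalSpace F E)] [∀ x, AddCommGroup (E x)]
    [∀ x, Module ℂ (E x)] [∀ x, TopologicalSpace (E x)] [∀ x, IsTopologicalAddGroup (E x)]
    [∀ x, ContinuousSMul ℂ (E x)] [FiberBundle F E] [VectorBundle ℂ F E]
    (x : M) (f : E x →ₗ[ℝ] E x) : E x →L[ℝ] E x :=
  haveI := (frameAt F E x).toHomeomorph.symm.t2Space
  haveI := finiteDimensional_of_equiv (frameAt F E x)
  LinearMap.toContinuousLinearMap f

namespace SkewForm

variable (D : SkewForm H F E) (g g' : HermitianMetric H F E) (x : M)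
  (v : TangentSpace 𝓘(ℝ, H) x)

/-- The block `E^{1,0} → E^{1,0}` of `𝒟_g^{0,1}`. -/
def block₁₁ : E x →L[ℝ] E x :=
  fibreEnd F x (LinearMap.fst ℝ (E x) (DualFiber E x) ∘ₗ (D.toFun x v).restrictScalars ℝ ∘ₗ
    LinearMap.inl ℝ (E x) (DualFiber E x))

/-- The block `E^{0,1} → E^{1,0}` of `𝒟_g^{0,1}`. -/
def block₁₂ : E x →L[ℝ] E x :=
  fibreEnd F x (LinearMap.fst ℝ (E x) (DualFiber E x) ∘ₗ (D.toFun x v).restrictScalars ℝ ∘ₗ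
    LinearMap.inr ℝ (E x) (DualFiber E x) ∘ₗ g.flatLinear x)

/-- The block `E^{1,0} → E^{0,1}` of `𝒟_g^{0,1}`. -/
def block₂₁ : E x →L[ℝ] E x :=
  fibreEnd F x (g.sharpLinear x ∘ₗ LinearMap.snd ℝ (E x) (DualFiber E x) ∘ₗ
    (D.toFun x v).restrictScalars ℝ ∘ₗ LinearMap.inl ℝ (E x) (DualFiber E x))

/-- The block `E^{0,1} → E^{0,1}` of `𝒟_g^{0,1}`. -/
def block₂₂ : E x →L[ℝ] E x :=
  fibreEnd F x (g.sharpLinear x ∘ₗ LinearMap.snd ℝ (E x) (DualFiber E x) ∘ₗ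
    (D.toFun x v).restrictScalars ℝ ∘ₗ LinearMap.inr ℝ (E x) (DualFiber E x) ∘ₗ g.flatLinear x)

theorem connectionForm_eq :
    connectionForm (g.connection D) x v = connectionForm g.chernConnection x v
      + (D.block₁₁ x v + D.block₁₂ g x v + D.block₂₁ g x v + D.block₂₂ g x v) := by
  ext u
  rw [connectionForm_connection]
  change _ + ((D.toFun x v (u, g.flat x u)).1 + g.sharp x (D.toFun x v (u, g.flat x u)).2)
    = _ + ((D.toFun x v (u, 0)).1 + (D.toFun x v (0, g.flat x u)).1
      + g.sharp x (D.toFun x v (u, 0)).2 + g.sharp x (D.toFun x v (0, g.flat x u)).2)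
  have h : (u, g.flat x u) = (u, 0) + (0, g.flat x u) := by simp
  rw [h, map_add, Prod.fst_add, Prod.snd_add, g.sharp_add]
  refine congrArg₂ (· + ·) rfl ?_
  abel

theorem toFun_I_left (u : E x) :
    D.toFun x v (Complex.I • u, 0) = Complex.I • D.toFun x v (u, 0) := by
  have h : ((Complex.I • u, 0) : DoubleFiber E x) = Complex.I • (u, 0) :=
    Prod.ext rfl (smul_zero (A := DualFiber E x) Complex.I).symm
  rw [h, (D.toFun x v).map_smul]

theorem toFun_I_right (μ : DualFiber E x) :
    D.toFun x v (0, Complex.I • μ) = Complex.I • D.toFun x v (0, μ) := by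
  have h : ((0, Complex.I • μ) : DoubleFiber E x) = Complex.I • (0, μ) :=
    Prod.ext (smul_zero Complex.I).symm rfl
  rw [h, (D.toFun x v).map_smul]

theorem toFun_neg_right (μ : DualFiber E x) :
    D.toFun x v (0, -μ) = -D.toFun x v (0, μ) := by
  have h : ((0, -μ) : DoubleFiber E x) = -(0, μ) := Prod.ext neg_zero.symm rfl
  rw [h]
  exact (D.toFun x v).map_neg _

theorem sharp_neg (μ : DualFiber E x) : g.sharp x (-μ) = -g.sharp x μ :=
  (g.sharpLinear x).map_neg μ

theorem block₁₁_comm : fibreJ E x * D.block₁₁ x v = D.block₁₁ x v * fibreJ E x := by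
  ext u
  change Complex.I • (D.toFun x v (u, 0)).1 = (D.toFun x v (Complex.I • u, 0)).1
  rw [toFun_I_left, Prod.smul_fst]

theorem block₁₂_anticomm :
    fibreJ E x * D.block₁₂ g x v = -(D.block₁₂ g x v * fibreJ E x) := by
  ext u
  change Complex.I • (D.toFun x v (0, g.flat x u)).1
    = -(D.toFun x v (0, g.flat x (Complex.I • u))).1
  rw [g.flat_I, toFun_neg_right, toFun_I_right, Prod.fst_neg, Prod.smul_fst, neg_neg]

theorem block₂₁_anticomm :
    fibreJ E x * D.block₂₁ g x v = -(D.block₂₁ g x v * fibreJ E x) := by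
  ext u
  change Complex.I • g.sharp x (D.toFun x v (u, 0)).2
    = -g.sharp x (D.toFun x v (Complex.I • u, 0)).2
  rw [toFun_I_left, Prod.smul_snd, g.sharp_I, neg_neg]

theorem block₂₂_comm : fibreJ E x * D.block₂₂ g x v = D.block₂₂ g x v * fibreJ E x := by
  ext u
  change Complex.I • g.sharp x (D.toFun x v (0, g.flat x u)).2
    = g.sharp x (D.toFun x v (0, g.flat x (Complex.I • u))).2
  rw [g.flat_I, toFun_neg_right, toFun_I_right, Prod.snd_neg, Prod.smul_snd, sharp_neg, g.sharp_I,
    neg_neg]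

theorem block₁₁_tangentI : D.block₁₁ x (tangentI x v) = -(fibreJ E x * D.block₁₁ x v) := by
  ext u
  change (D.toFun x (tangentI x v) (u, 0)).1 = -(Complex.I • (D.toFun x v (u, 0)).1)
  rw [D.type_zero_one, Prod.fst_neg, Prod.smul_fst]

theorem block₁₂_tangentI : D.block₁₂ g x (tangentI x v) = -(fibreJ E x * D.block₁₂ g x v) := by
  ext u
  change (D.toFun x (tangentI x v) (0, g.flat x u)).1
    = -(Complex.I • (D.toFun x v (0, g.flat x u)).1)
  rw [D.type_zero_one, Prod.fst_neg, Prod.smul_fst]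

theorem block₂₁_tangentI : D.block₂₁ g x (tangentI x v) = fibreJ E x * D.block₂₁ g x v := by
  ext u
  change g.sharp x (D.toFun x (tangentI x v) (u, 0)).2
    = Complex.I • g.sharp x (D.toFun x v (u, 0)).2
  rw [D.type_zero_one, Prod.snd_neg, Prod.smul_snd, sharp_neg, g.sharp_I, neg_neg]

theorem block₂₂_tangentI : D.block₂₂ g x (tangentI x v) = fibreJ E x * D.block₂₂ g x v := by
  ext u
  change g.sharp x (D.toFun x (tangentI x v) (0, g.flat x u)).2
    = Complex.I • g.sharp x (D.toFun x v (0, g.flat x u)).2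
  rw [D.type_zero_one, Prod.snd_neg, Prod.smul_snd, sharp_neg, g.sharp_I, neg_neg]

theorem block₁₂_mul_comparison : D.block₁₂ g' x v * g.comparison g' x = D.block₁₂ g x v := by
  ext u
  change (D.toFun x v (0, g'.flat x (g.comparison g' x u))).1 = (D.toFun x v (0, g.flat x u)).1
  rw [g.flat_comparison]

theorem block₂₁_eq : D.block₂₁ g' x v = g.comparison g' x * D.block₂₁ g x v := by
  ext u
  exact g.sharp_eq_comparison g' _

theorem block₂₂_mul_comparison :
    D.block₂₂ g' x v * g.comparison g' x = g.comparison g' x * D.block₂₂ g x v := by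
  ext u
  change g'.sharp x (D.toFun x v (0, g'.flat x (g.comparison g' x u))).2
    = g.comparison g' x (g.sharp x (D.toFun x v (0, g.flat x u)).2)
  rw [g.flat_comparison, g.sharp_eq_comparison g']

end SkewForm

theorem comparisonDeriv_eq (g g' : HermitianMetric H F E) (x : M) (v : TangentSpace 𝓘(ℝ, H) x) :
    g.comparisonDeriv g' x v = g.comparison g' x * connectionForm g.chernConnection x v
      - connectionForm g'.chernConnection x v * g.comparison g' x
      + g.comparisonDefect g' x v := by
  rw [HermitianMetric.comparisonDefect]
  abel

theorem fibrewiseBiholomorphic_connection (g g' : HermitianMetric H F E) (D : SkewForm H F E) :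
    FibrewiseBiholomorphic g.twistorSpace (twistorJ (g.connection D))
      g'.twistorSpace (twistorJ (g'.connection D)) := by
  refine fibrewiseBiholomorphic_of_defect g g' _ _ fun x K v hK => ?_
  rw [D.connectionForm_eq, D.connectionForm_eq, D.connectionForm_eq, D.connectionForm_eq,
    D.block₂₁_eq g g', D.block₂₁_eq g g']
  exact twist_defect_type (fibreJ_mul_fibreJ x) hK (g.fibreJ_mul_comparison g' x)
    (comparisonDeriv_eq g g' x v) (comparisonDeriv_eq g g' x _) (g.comparisonDefect_comm g' v)
    (g.chern_comm v) (g'.chern_comm v) (D.block₁₁_comm x v) (D.block₁₂_anticomm g x v)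
    (D.block₂₁_anticomm g x v) (D.block₂₂_comm g x v) (D.block₁₂_anticomm g' x v)
    (D.block₂₂_comm g' x v) (D.block₁₂_mul_comparison g g' x v) (D.block₂₂_mul_comparison g g' x v)
    (g.chern_tangentI v) (g'.chern_tangentI v) (g.comparisonDefect_tangentI g' v)
    (D.block₁₁_tangentI x v) (D.block₁₂_tangentI g x v) (D.block₁₂_tangentI g' x v)
    (D.block₂₁_tangentI g x v) (D.block₂₂_tangentI g x v) (D.block₂₂_tangentI g' x v)

theorem fibrewiseBiholomorphic_chernConnection (g g' : HermitianMetric H F E) :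
    FibrewiseBiholomorphic g.twistorSpace (twistorJ g.chernConnection)
      g'.twistorSpace (twistorJ g'.chernConnection) := by
  refine fibrewiseBiholomorphic_of_defect g g' _ _ fun x K v hK => ?_
  have h := twist_defect_type (p := 0) (p₂ := 0) (q := 0) (q₂ := 0) (q' := 0) (q₂' := 0) (r := 0)
    (r₂ := 0) (s := 0) (s₂ := 0) (s' := 0) (s₂' := 0) (fibreJ_mul_fibreJ x) hK
    (g.fibreJ_mul_comparison g' x)
    (comparisonDeriv_eq g g' x v) (comparisonDeriv_eq g g' x _) (g.comparisonDefect_comm g' v)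
    (g.chern_comm v) (g'.chern_comm v) (by simp) (by simp) (by simp) (by simp) (by simp) (by simp)
    (by simp) (by simp) (g.chern_tangentI v) (g'.chern_tangentI v)
    (g.comparisonDefect_tangentI g' v) (by simp) (by simp) (by simp) (by simp) (by simp) (by simp)
  simpa only [add_zero, mul_zero, HermitianMetric.twistAt] using h

end TwistorSpace

end

theorem mainTheorem8 {H : Type*} [NormedAddCommGroup H] [NormedSpace ℂ H] [FiniteDimensional ℂ H]
    {M : Type*} [TopologicalSpace M] [ChartedSpace H M] [IsManifold 𝓘(ℂ, H) ω M]
    {F : Type*} [NormedAddCommGroup F] [NormedSpace ℂ F] [FiniteDimensional ℂ F]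
    {E : M → Type*} [TopologicalSpace (TotalSpace F E)]
    [∀ x, AddCommGroup (E x)] [∀ x, Module ℂ (E x)] [∀ x, TopologicalSpace (E x)]
    [∀ x, IsTopologicalAddGroup (E x)] [∀ x, ContinuousSMul ℂ (E x)]
    [FiberBundle F E] [VectorBundle ℂ F E] [ContMDiffVectorBundle ω F E 𝓘(ℂ, H)]
    (g g' : TwistorSpace.HermitianMetric H F E) :
    (∀ D : TwistorSpace.SkewForm H F E,
      TwistorSpace.FibrewiseBiholomorphic
        g.twistorSpace (TwistorSpace.twistorJ (g.connection D))
        g'.twistorSpace (TwistorSpace.twistorJ (g'.connection D))) ∧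
    TwistorSpace.FibrewiseBiholomorphic
      g.twistorSpace (TwistorSpace.twistorJ g.chernConnection)
      g'.twistorSpace (TwistorSpace.twistorJ g'.chernConnection) :=
  ⟨fun D => TwistorSpace.fibrewiseBiholomorphic_connection g g' D,
    TwistorSpace.fibrewiseBiholomorphic_chernConnection g g'⟩
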